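/- Let $K$ be a field of characteristic zero (for instance $\mathbb{R}$ or $\mathbb{C}$), let $n,r\ge 0$ be integers with $n$ even, and put $V=\{1,\dots,n\}$, $R=\{n+1,\dots,n+r\}$, $V^R=V\cup R$. Let $A^R=(a_{ij})_{i,j\in V^R}$ be a skew-symmetric matrix over $K$ with $\sum_{j\in V^R}a_{ij}=0$ for all $i\in V^R$, and let $A=(a_{ij})_{i,j\in V}$ be its top-left $n\times n$ block, with Pfaffian $$\mathrm{Pf}(A)=\frac{1}{2^{n/2}(n/2)!}\sum_{\sigma\in S_n}\mathrm{sgn}(\sigma)\,a_{\sigma(1)\sigma(2)}\cdots a_{\sigma(n-1)\sigma(n)}.$$ Let $G^R$ be the graph on $V^R$ in which $i$ and $j$ are adjacent if and only if $a_{ij}\ne 0$, and let $G$ be the graph on $V$ defined in the same way from $A$. A spanning forest of $G^R$ (rooted in $R$) is a set $F$ of oriented edges of $G^R$ containing no cycle, such that each vertex of $V$ has exactly one outgoing edge in $F$ and vertices of $R$ have none; equivalently, $F$ spans $V$ and each connected component is a tree containing exactly one vertex of $R$, its root, with all edges oriented towards it. Given a perfect matching $M_0$ of $G$, the forest $F$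 is compatible with $M_0$ if it consists of the $n/2$ edges of $M_0$ (with some orientation) and of $n/2$ edges not in $M_0$; the set $F\setminus M_0$ of the latter oriented edges is called a half-spanning forest. Trimming algorithm. Let $F_1=F$. As long as $F_i\neq\emptyset$, let $\ell_i$ be the leaf of $F_i$ with the largest label, where a leaf is a vertex with an outgoing edge but no incoming edge in $F_i$. Starting from $\ell_i$, follow the oriented edges of $F_i$ along at least one edge until the first time that one of the following vertices is reached: a root (a vertex of $R$), a vertex with more than one incoming edge in $F_i$, or a vertex smaller than $\ell_i$. Let $\lambda_i$ be the resulting path, and let $F_{i+1}=F_i\setminus\lambda_i$ be obtained by deleting its edges. A spanning forest $F$ compatible with $M_0$ satisfies Condition (C) if each of the paths $\lambda_1,\lambda_2,\dots$ so obtained starts with an edge of $M_0$ and has an even number of edges. Let $\mathcal{F}(M_0)$ be the set of spanning forests of $G^R$ that are compatible with $M_0$ and satisfy Condition (C). For $F\in\mathcal{F}(M_0)$, orient the edges of $M_0$ as they are oriented in $F$, list them in any order as $(i_1,i_2),\dots,(i_{n-1},i_n)$, and let $\sigma_{M_0(F\setminus M_0)}\in S_n$ be the permutation $k\mapsto i_k$;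 its sign does not depend on the order of the list. Then, for every perfect matching $M_0$ of $G$, $$\mathrm{Pf}(A)=\sum_{F\in\mathcal{F}(M_0)}\mathrm{sgn}\bigl(\sigma_{M_0(F\setminus M_0)}\bigr)\prod_{(i,j)\in F\setminus M_0}a_{ij}.$$ -/

import Mathlib

open scoped BigOperators

namespace PfaffianHalfTree

/-- The Pfaffian of an `n × n` matrix, by the sum over all permutations (indices start at `0`,
so the `k`-th factor is the entry at `(σ (2k), σ (2k+1))`); it is `0` by convention for odd `n`. -/
noncomputable def pfaffian {K : Type*} [Field K] {n : ℕ} (A : Matrix (Fin n) (Fin n) K) : K :=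
  if Even n then
    ((2 : K) ^ (n / 2) * ((n / 2).factorial : K))⁻¹ *
      ∑ σ : Equiv.Perm (Fin n), ((Equiv.Perm.sign σ : ℤ) : K) *
        ∏ k : Fin (n / 2),
          A (σ ⟨2 * k.val, by have := k.isLt; omega⟩) (σ ⟨2 * k.val + 1, by have := k.isLt; omega⟩)
  else 0

/-- The graph of a skew-symmetric matrix: `i` and `j` are adjacent when the entry at `(i, j)` is
nonzero (see `matrixGraph_adj`). -/
def matrixGraph {K : Type*} [Field K] {N : ℕ} (A : Matrix (Fin N) (Fin N) K) :
    SimpleGraph (Fin N) :=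
  SimpleGraph.fromRel (fun i j => A i j ≠ 0)

theorem matrixGraph_adj {K : Type*} [Field K] [CharZero K] {N : ℕ}
    (A : Matrix (Fin N) (Fin N) K) (hA : A.transpose = -A) (i j : Fin N) :
    (matrixGraph A).Adj i j ↔ A i j ≠ 0 := by
  have h : ∀ a b, A b a = -A a b := fun a b => congrFun (congrFun hA a) b
  have hd : A i i = 0 := self_eq_neg.mp (h i i)
  simp only [matrixGraph, SimpleGraph.fromRel_adj, h i j, neg_ne_zero, or_self]
  constructor
  · exact fun h => h.2
  · intro hne
    refine ⟨?_, hne⟩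
    rintro rfl
    exact hne hd

/-- The block of a matrix indexed by the first `n` indices. -/
def topLeft {K : Type*} {n r : ℕ} (AR : Matrix (Fin (n + r)) (Fin (n + r)) K) :
    Matrix (Fin n) (Fin n) K :=
  AR.submatrix (Fin.castAdd r) (Fin.castAdd r)

/-- Sets of oriented edges on `N` labelled vertices; `(u, v)` is the edge from `u` to `v`. -/
abbrev OrientedEdges (N : ℕ) : Type := Finset (Fin N × Fin N)

/-- Spanning forests of a graph on the vertex set `V ∪ R`, where `V` consists of the first `n`
vertices and `R` of the last `r` ones: oriented edge configurations without (oriented) cycle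
(in particular every edge has only one orientation) in which every vertex of `V` has
exactly one outgoing edge and the vertices of `R`, being roots, have none. -/
structure IsSpanningForest {n r : ℕ} (G : SimpleGraph (Fin (n + r)))
    (F : OrientedEdges (n + r)) : Prop where
  adj : ∀ e ∈ F, G.Adj e.1 e.2
  exists_unique_out : ∀ v : Fin n, ∃! w, (Fin.castAdd r v, w) ∈ F
  root_out : ∀ (ρ : Fin r) (w : Fin (n + r)), (Fin.natAdd n ρ, w) ∉ F
  no_cycle : ∀ v, ¬ Relation.TransGen (fun u w => (u, w) ∈ F) v v

/-- The (unoriented) edges of a subgraph on `V`, seen as edges on `V ∪ R`. -/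
def liftedEdges {n : ℕ} (r : ℕ) {G : SimpleGraph (Fin n)} (M : G.Subgraph) :
    Set (Sym2 (Fin (n + r))) :=
  Sym2.map (Fin.castAdd r) '' M.edgeSet

open Classical in
/-- The half-forest `F ∖ M`: the oriented edges of `F` whose underlying edge is not in `M`. -/
noncomputable def halfForest {n r : ℕ} {G : SimpleGraph (Fin n)} (M : G.Subgraph)
    (F : OrientedEdges (n + r)) : OrientedEdges (n + r) :=
  F.filter (fun e => s(e.1, e.2) ∉ liftedEdges r M)

/-- `F` consists of all the edges of `M` (each with some orientation) and of `|V| / 2` edges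
not in `M`. -/
def IsCompatible {n r : ℕ} {G : SimpleGraph (Fin n)} (M : G.Subgraph)
    (F : OrientedEdges (n + r)) : Prop :=
  (∀ a ∈ liftedEdges r M, ∃ e ∈ F, s(e.1, e.2) = a) ∧ (halfForest M F).card = n / 2

/-! ### The trimming algorithm -/

/-- A leaf of a (partially trimmed) forest: a vertex which still has an outgoing edge but has no
incoming edge. -/
def IsLeaf {N : ℕ} (F : OrientedEdges N) (v : Fin N) : Prop :=
  (∃ w, (v, w) ∈ F) ∧ ∀ u, (u, v) ∉ F

/-- The leaf with the largest label. -/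
def IsLargestLeaf {N : ℕ} (F : OrientedEdges N) (l : Fin N) : Prop :=
  IsLeaf F l ∧ ∀ v, IsLeaf F v → v ≤ l

/-- A fork: a vertex with more than one incoming edge. -/
def IsFork {N : ℕ} (F : OrientedEdges N) (v : Fin N) : Prop :=
  ∃ u u', u ≠ u' ∧ (u, v) ∈ F ∧ (u', v) ∈ F

/-- The vertices at which a path started at the leaf `l` stops: roots (the vertices with
label at least `n`), forks, and vertices smaller than `l`. -/
def IsStop (n : ℕ) {N : ℕ} (F : OrientedEdges N) (l v : Fin N) : Prop :=
  n ≤ v.val ∨ IsFork F v ∨ v < l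

/-- The list of consecutive oriented edges of a path given by its list of vertices. -/
def pathEdges {N : ℕ} (p : List (Fin N)) : List (Fin N × Fin N) := p.zip p.tail

/-- `p` is the path of one step of the trimming algorithm: it starts at the largest leaf `l`,
follows oriented edges of `F`, has at least one edge, and ends the first time that a
stopping vertex `w` is reached (`q` lists the vertices strictly between `l` and `w`). -/
def IsTrimmingPath (n : ℕ) {N : ℕ} (F : OrientedEdges N) (p : List (Fin N)) : Prop :=
  ∃ (l : Fin N) (q : List (Fin N)) (w : Fin N),
    p = l :: (q ++ [w]) ∧ IsLargestLeaf F l ∧ (∀ e ∈ pathEdges p, e ∈ F) ∧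
      (∀ x ∈ q, ¬ IsStop n F l x) ∧ IsStop n F l w

/-- `IsTrimming n F ps`: the trimming algorithm with input `F` terminates and produces the
paths `ps`, in this order. -/
inductive IsTrimming (n : ℕ) {N : ℕ} : OrientedEdges N → List (List (Fin N)) → Prop
  | done : IsTrimming n ∅ []
  | step (F : OrientedEdges N) (p : List (Fin N)) (ps : List (List (Fin N))) :
      IsTrimmingPath n F p → IsTrimming n (F \ (pathEdges p).toFinset) ps →
        IsTrimming n F (p :: ps)

/-- Condition (C): every path obtained from the trimming algorithm starts from an edge of `M`
and has even length (number of edges). -/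
def ConditionC {n r : ℕ} {G : SimpleGraph (Fin n)} (M : G.Subgraph)
    (F : OrientedEdges (n + r)) : Prop :=
  ∃ ps, IsTrimming n F ps ∧ ∀ p ∈ ps,
    (∃ e, (pathEdges p).head? = some e ∧ s(e.1, e.2) ∈ liftedEdges r M) ∧
      Even (pathEdges p).length

open Classical in
/-- The spanning forests of `GR` that are compatible with `M` and satisfy Condition (C). -/
noncomputable def forests {n r : ℕ} (GR : SimpleGraph (Fin (n + r))) {G : SimpleGraph (Fin n)}
    (M : G.Subgraph) : Finset (OrientedEdges (n + r)) :=
  Finset.univ.filter (fun F => IsSpanningForest GR F ∧ IsCompatible M F ∧ ConditionC M F)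

/-- `σ` is the permutation `k ↦ i_k` for a description `(i_1, i_2), …, (i_{n-1}, i_n)` of the
matching `M` whose edges carry the orientation induced by `F`. -/
def IsDescription {n r : ℕ} {G : SimpleGraph (Fin n)} (M : G.Subgraph)
    (F : OrientedEdges (n + r)) (σ : Equiv.Perm (Fin n)) : Prop :=
  ∀ (k : ℕ) (hk : 2 * k + 1 < n),
    M.Adj (σ ⟨2 * k, by omega⟩) (σ ⟨2 * k + 1, hk⟩) ∧
      (Fin.castAdd r (σ ⟨2 * k, by omega⟩), Fin.castAdd r (σ ⟨2 * k + 1, hk⟩)) ∈ F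

end PfaffianHalfTree

/-!
# The Pfaffian half-tree theorem

Number the two ends of the `k`-th edge of the matching by slots `(k, false)` and `(k, true)`, let
`v` send a slot to its vertex, and write `Pf_K` for the Pfaffian of the rows in the pairs of a set
`K`. No cancellation takes place in the proof: the Pfaffian satisfies the recursion by which the
forests of Condition (C) can be grown.

*Algebra.* Let `x` be a slot of `K` and `y` its mate. As the rows of the full matrix sum to zero
and a Pfaffian with a repeated row vanishes, `Pf_K = -∑ Pf_K[x ← w]`, where `w` runs over the
vertices outside `K` (`subPf_eq_neg_sum`). Expanding `-Pf_K[x ← w]` along the row of `y`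
(`subPf_update`), either `y` is matched with `w`, which leaves the Pfaffian without the pair of `x`
and `y`, or `y` is matched with another row `s`, and `w` takes the place of `s`, which is a term of
the same shape without that pair. Iterating, one walks along a path `x → y → s → mate s → ⋯` through
distinct pairs, until it ends in a vertex outside the original `K`; the Pfaffian of the unused pairs
remains, and a new path is begun. If each path starts at the smallest unused vertex, this describes
the forests of `Grows`, and `sum_grows` is the resulting formula.

*Combinatorics.* These forests are those of Condition (C). The trimming algorithm
removes the paths in the reverse order: the starts of the grown paths increase, a path from the
smallest unused vertex meets no stopping vertex before its end, and its end is a root, becomes a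
fork, or is an earlier, hence smaller, leaf (`IsStage.grow`). Conversely, a trimming path that
begins with a matching edge and has even length alternates, since it would otherwise enter a pair at
a fork (`IsStage.altPath_of_path`), and it starts at the smallest vertex of all pairs trimmed so far
(`IsStage.trim`). Both directions are inductions over `IsStage`, the invariant of a partially grown
or partially trimmed forest.

*Signs.* Each matching edge contributes the sign of its orientation relative to the reference
orientation; the product of these signs compares the permutation of the forest with the
reference one (`sign_eq_prod_slotSign`, `sign_mul_prod_halfForest`).
-/

open scoped BigOperators

namespace PfaffianHalfTree

/-! ### Pfaffians indexed by pairs of slots -/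

section Algebra

variable {𝕜 : Type*} [Field 𝕜] {W : Type*} {ι κ : Type*}

/-- The other slot of the same pair. -/
def mate (x : ι × Bool) : ι × Bool := (x.1, !x.2)

@[simp] theorem mate_fst (x : ι × Bool) : (mate x).1 = x.1 := rfl

@[simp] theorem mate_mate (x : ι × Bool) : mate (mate x) = x := by simp [mate]

theorem mate_ne (x : ι × Bool) : mate x ≠ x := by
  intro h
  have := congrArg Prod.snd h
  simp [mate] at this

theorem eq_or_eq_mate {x y : ι × Bool} (h : x.1 = y.1) : x = y ∨ x = mate y := by
  obtain ⟨a, b⟩ := x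
  obtain ⟨c, d⟩ := y
  simp only at h
  subst h
  cases b <;> cases d <;> simp [mate]

variable [Fintype ι] [DecidableEq ι] [Fintype κ] [DecidableEq κ]

/-- The contribution of a permutation `σ` of the slots to the Pfaffian of the entries
`A (v x) (v y)`. -/
def pfTerm (A : Matrix W W 𝕜) (v : ι × Bool → W) (σ : Equiv.Perm (ι × Bool)) : 𝕜 :=
  ((Equiv.Perm.sign σ : ℤ) : 𝕜) * ∏ k, A (v (σ (k, false))) (v (σ (k, true)))

/-- The Pfaffian of the skew-symmetric array `A (v x) (v y)`, where `x` and `y` run over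
`ι × Bool`: the rows are grouped into pairs instead of being numbered, and `v` need not be
injective, which makes the Pfaffian a function of its rows. -/
def pf (A : Matrix W W 𝕜) (v : ι × Bool → W) : 𝕜 :=
  ((2 : 𝕜) ^ Fintype.card ι * ((Fintype.card ι).factorial : 𝕜))⁻¹ * ∑ σ, pfTerm A v σ

theorem pf_reindex (A : Matrix W W 𝕜) (e : κ ≃ ι) (v : ι × Bool → W) :
    pf A (fun x : κ × Bool => v (e x.1, x.2)) = pf A v := by
  unfold pf
  rw [Fintype.card_congr e]
  congr 1
  refine Fintype.sum_equiv (e.prodCongr (Equiv.refl Bool)).permCongr _ _ fun σ => ?_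
  unfold pfTerm
  rw [Equiv.Perm.sign_permCongr]
  congr 1
  refine Fintype.prod_equiv e _ _ fun k => ?_
  simp only [Equiv.permCongr_apply, Equiv.prodCongr_symm, Equiv.prodCongr_apply, Prod.map_apply,
    Equiv.symm_apply_apply, Equiv.refl_symm, Equiv.coe_refl, id_eq]
  rfl

theorem pf_comp_perm (A : Matrix W W 𝕜) (v : ι × Bool → W) (π : Equiv.Perm (ι × Bool)) :
    pf A (v ∘ π) = ((Equiv.Perm.sign π : ℤ) : 𝕜) * pf A v := by
  unfold pf
  rw [mul_left_comm]
  congr 1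
  rw [Finset.mul_sum]
  refine Fintype.sum_equiv (Equiv.mulLeft π) _ _ fun σ => ?_
  unfold pfTerm
  have h : ((Equiv.Perm.sign π : ℤ) : 𝕜) * ((Equiv.Perm.sign π : ℤ) : 𝕜) = 1 := by
    rw [← Int.cast_mul, ← Units.val_mul, Int.units_mul_self]; simp
  simp only [Equiv.coe_mulLeft, Equiv.Perm.sign_mul, Units.val_mul, Int.cast_mul,
    Equiv.Perm.mul_apply, Function.comp_apply]
  rw [← mul_assoc, ← mul_assoc, h, one_mul]

theorem pf_eq_zero_of_eq [CharZero 𝕜] (A : Matrix W W 𝕜) (v : ι × Bool → W) {s t : ι × Bool}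
    (hst : s ≠ t) (h : v s = v t) : pf A v = 0 := by
  have hv : v ∘ Equiv.swap s t = v := by
    funext x
    simp only [Function.comp_apply, Equiv.swap_apply_def]
    split_ifs with h1 h2
    · rw [h1, h]
    · rw [h2, h]
    · rfl
  have := pf_comp_perm A v (Equiv.swap s t)
  rw [hv, Equiv.Perm.sign_swap hst] at this
  simp only [Units.val_neg, Units.val_one, Int.cast_neg, Int.cast_one, neg_mul, one_mul] at this
  exact self_eq_neg.mp this

theorem sum_pf_update [Fintype W] (A : Matrix W W 𝕜) (hskew : ∀ i j, A i j = -A j i)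
    (hsum : ∀ i, ∑ j, A i j = 0) (v : ι × Bool → W) (s : ι × Bool) :
    ∑ w, pf A (Function.update v s w) = 0 := by
  unfold pf
  rw [← Finset.mul_sum, Finset.sum_comm]
  refine mul_eq_zero_of_right _ (Finset.sum_eq_zero fun σ _ => ?_)
  unfold pfTerm
  rw [← Finset.mul_sum]
  refine mul_eq_zero_of_right _ ?_
  have hsum' : ∀ i, ∑ j, A j i = 0 := fun i => by
    simp_rw [fun j => hskew j i, Finset.sum_neg_distrib, hsum, neg_zero]
  -- Only the factor indexed by the pair containing `σ⁻¹ s` involves the new entry.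
  obtain ⟨⟨k, b⟩, hk⟩ := σ.surjective s
  simp_rw [← Finset.mul_prod_erase Finset.univ _ (Finset.mem_univ k)]
  have hrest : ∀ w, ∏ l ∈ Finset.univ.erase k, A (Function.update v s w (σ (l, false)))
      (Function.update v s w (σ (l, true))) =
      ∏ l ∈ Finset.univ.erase k, A (v (σ (l, false))) (v (σ (l, true))) := fun w => by
    refine Finset.prod_congr rfl fun l hl => ?_
    have hne : ∀ c, σ (l, c) ≠ s := fun c hc => by
      rw [← hk] at hc
      exact Finset.ne_of_mem_erase hl (congrArg Prod.fst (σ.injective hc))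
    rw [Function.update_of_ne (hne _), Function.update_of_ne (hne _)]
  simp_rw [hrest, ← Finset.sum_mul]
  refine mul_eq_zero_of_left ?_ _
  have hne : σ (k, !b) ≠ s := fun hc => by
    rw [← hk] at hc
    simpa using congrArg Prod.snd (σ.injective hc)
  cases b
  · simp only [hk, Function.update_self, Bool.not_false] at hne ⊢
    simp only [Function.update_of_ne hne, hsum']
  · simp only [hk, Function.update_self, Bool.not_true] at hne ⊢
    simp only [Function.update_of_ne hne, hsum]

/-! ### Expansion of the Pfaffian along a row -/

theorem pfTerm_mul_pairs (A : Matrix W W 𝕜) (v : ι × Bool → W) (σ : Equiv.Perm (ι × Bool))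
    (ρ : Equiv.Perm ι) :
    pfTerm A v (σ * Equiv.prodCongrLeft fun _ => ρ) = pfTerm A v σ := by
  unfold pfTerm
  congr 1
  · simp [Equiv.Perm.sign_mul, Equiv.Perm.sign_prodCongrLeft]
  · refine Fintype.prod_equiv ρ _ _ fun k => ?_
    simp [Equiv.prodCongrLeft]

theorem pfTerm_mul_swap (A : Matrix W W 𝕜) (hskew : ∀ i j, A i j = -A j i) (v : ι × Bool → W)
    (σ : Equiv.Perm (ι × Bool)) (k : ι) :
    pfTerm A v (σ * Equiv.swap (k, false) (k, true)) = pfTerm A v σ := by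
  unfold pfTerm
  rw [Equiv.Perm.sign_mul, Equiv.Perm.sign_swap (by simp)]
  rw [← Finset.mul_prod_erase Finset.univ _ (Finset.mem_univ k),
    ← Finset.mul_prod_erase Finset.univ _ (Finset.mem_univ k)]
  have hrest : ∏ l ∈ Finset.univ.erase k,
      A (v ((σ * Equiv.swap (k, false) (k, true)) (l, false)))
        (v ((σ * Equiv.swap (k, false) (k, true)) (l, true))) =
      ∏ l ∈ Finset.univ.erase k, A (v (σ (l, false))) (v (σ (l, true))) := by
    refine Finset.prod_congr rfl fun l hl => ?_
    have hl := Finset.ne_of_mem_erase hl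
    simp [Equiv.swap_apply_of_ne_of_ne, hl]
  rw [hrest]
  simp only [Equiv.Perm.mul_apply, Equiv.swap_apply_left, Equiv.swap_apply_right]
  rw [hskew (v (σ (k, true)))]
  simp

theorem sum_pfTerm_eq (A : Matrix W W 𝕜) (hskew : ∀ i j, A i j = -A j i) (v : ι × Bool → W)
    (k₀ : ι) :
    ∑ σ, pfTerm A v σ = (2 * Fintype.card ι : 𝕜) *
      ∑ σ with σ (k₀, false) = (k₀, false), pfTerm A v σ := by
  rw [← Finset.sum_fiberwise Finset.univ (fun σ : Equiv.Perm (ι × Bool) => σ.symm (k₀, false))]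
  have key : ∀ s : ι × Bool, ∑ σ with σ.symm (k₀, false) = s, pfTerm A v σ =
      ∑ σ with σ (k₀, false) = (k₀, false), pfTerm A v σ := fun s => by
    -- Move the slot `s` to `(k₀, false)` by a permutation that does not change the terms.
    obtain ⟨g, hg, hinv⟩ : ∃ g : Equiv.Perm (ι × Bool), g (k₀, false) = s ∧
        ∀ σ, pfTerm A v (σ * g) = pfTerm A v σ := by
      obtain ⟨k, b⟩ := s
      cases b
      · exact ⟨Equiv.prodCongrLeft fun _ => Equiv.swap k₀ k, by simp [Equiv.prodCongrLeft],
          fun σ => pfTerm_mul_pairs A v σ _⟩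
      · refine ⟨Equiv.swap (k, false) (k, true) * Equiv.prodCongrLeft fun _ => Equiv.swap k₀ k,
          by simp [Equiv.prodCongrLeft], fun σ => ?_⟩
        rw [← mul_assoc, pfTerm_mul_pairs, pfTerm_mul_swap A hskew]
    refine Finset.sum_bij' (fun σ _ => σ * g) (fun σ _ => σ * g⁻¹) ?_ ?_ ?_ ?_ ?_
    · intro σ hσ
      simp only [Finset.mem_filter, Finset.mem_univ, true_and] at hσ ⊢
      rw [Equiv.Perm.mul_apply, hg, ← hσ, Equiv.apply_symm_apply]
    · intro σ hσ
      simp only [Finset.mem_filter, Finset.mem_univ, true_and] at hσ ⊢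
      rw [Equiv.symm_apply_eq, Equiv.Perm.mul_apply, ← hg, Equiv.Perm.inv_def,
        Equiv.symm_apply_apply, hσ]
    · intro σ _; simp
    · intro σ _; simp
    · intro σ _; exact (hinv σ).symm
  simp_rw [key]
  simp [mul_comm]

/-- The slots of `Option ι`, with the two slots of the additional pair singled out. -/
def slotsOption (ι : Type*) : Option (Option (ι × Bool)) ≃ Option ι × Bool where
  toFun
    | none => (none, false)
    | some none => (none, true)
    | some (some (i, b)) => (some i, b)
  invFun
    | (none, false) => none
    | (none, true) => some none
    | (some i, b) => some (some (i, b))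
  left_inv := by rintro (_ | _ | ⟨i, b⟩) <;> rfl
  right_inv := by rintro ⟨_ | i, b⟩ <;> cases b <;> rfl

theorem sum_perm_fixing_none {α M : Type*} [Fintype α] [DecidableEq α] [AddCommMonoid M]
    (f : Equiv.Perm (Option α) → M) :
    ∑ σ with σ none = none, f σ = ∑ τ : Equiv.Perm α, f (Equiv.optionCongr τ) := by
  rw [Finset.sum_filter, ← Equiv.Perm.decomposeOption.symm.sum_comp, Fintype.sum_prod_type]
  simp only [Equiv.Perm.decomposeOption, Equiv.coe_fn_symm_mk, Equiv.Perm.mul_apply,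
    Equiv.optionCongr_apply, Option.map_none, Equiv.swap_apply_left, Fintype.sum_option,
    Equiv.swap_self, if_true, reduceCtorEq, if_false, Finset.sum_const_zero, add_zero]
  exact Finset.sum_congr rfl fun τ _ => congrArg f (one_mul _)

theorem pf_option [CharZero 𝕜] (A : Matrix W W 𝕜) (hskew : ∀ i j, A i j = -A j i)
    (v : Option ι × Bool → W) :
    pf A v = A (v (none, false)) (v (none, true)) *
        pf A (fun x : ι × Bool => v (some x.1, x.2)) -
      ∑ s : ι × Bool, A (v (none, false)) (v (some s.1, s.2)) *
        pf A (Function.update (fun x : ι × Bool => v (some x.1, x.2)) s (v (none, true))) := by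
  set u : ι × Bool → W := fun x => v (some x.1, x.2) with hu
  have key : ∑ σ with σ (none, false) = (none, false), pfTerm A v σ =
      A (v (none, false)) (v (none, true)) * ∑ σ, pfTerm A u σ -
      ∑ s : ι × Bool, A (v (none, false)) (u s) *
        ∑ σ, pfTerm A (Function.update u s (v (none, true))) σ := by
    have h1 : ∑ σ with σ (none, false) = (none, false), pfTerm A v σ =
        ∑ σ with σ none = none, pfTerm A v ((slotsOption ι).permCongr σ) := by
      rw [Finset.sum_filter, Finset.sum_filter, ← (slotsOption ι).permCongr.sum_comp]
      refine Finset.sum_congr rfl fun σ _ => if_congr ?_ rfl rfl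
      rw [Equiv.permCongr_apply, ← Equiv.eq_symm_apply]
      rfl
    rw [h1, sum_perm_fixing_none, ← Equiv.Perm.decomposeOption.symm.sum_comp,
      Fintype.sum_prod_type, Fintype.sum_option, sub_eq_add_neg, ← Finset.sum_neg_distrib]
    congr 1
    · rw [Finset.mul_sum]
      refine Finset.sum_congr rfl fun τ _ => ?_
      unfold pfTerm
      rw [Equiv.Perm.sign_permCongr, Equiv.optionCongr_sign, Equiv.Perm.decomposeOption_symm_sign,
        Fintype.prod_option]
      simp [slotsOption, Equiv.permCongr_apply, Equiv.Perm.decomposeOption, hu]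
      ring
    · refine Finset.sum_congr rfl fun s _ => ?_
      rw [Finset.mul_sum, ← Finset.sum_neg_distrib]
      refine Finset.sum_congr rfl fun τ _ => ?_
      unfold pfTerm
      have hsign : Equiv.Perm.sign (Equiv.Perm.decomposeOption.symm (some s, τ)) =
          -Equiv.Perm.sign τ := by
        simp [Equiv.Perm.decomposeOption]
      rw [Equiv.Perm.sign_permCongr, Equiv.optionCongr_sign, hsign, Fintype.prod_option]
      have hval : ∀ x : ι × Bool, v (slotsOption ι (some (Equiv.swap none (some s) (some (τ x))))) =
          Function.update u s (v (none, true)) (τ x) := fun x => by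
        by_cases hx : τ x = s
        · rw [hx, Equiv.swap_apply_right, Function.update_self]
          rfl
        · rw [Function.update_of_ne hx, Equiv.swap_apply_of_ne_of_ne (by simp) (by simpa using hx)]
          rfl
      have hslot : ∀ (i : ι) (b : Bool), (slotsOption ι).symm (some i, b) = some (some (i, b)) :=
        fun _ _ => rfl
      have e0 : (slotsOption ι).symm (none, false) = none := rfl
      have e1 : (slotsOption ι).symm (none, true) = some none := rfl
      have e2 : slotsOption ι none = (none, false) := rfl
      have e3 : v (slotsOption ι (some (some s))) = u s := rfl
      simp only [Equiv.permCongr_apply, Equiv.Perm.decomposeOption, Equiv.coe_fn_symm_mk,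
        hslot, e0, e1, e2, Equiv.optionCongr_apply, Option.map_none, Option.map_some,
        Equiv.Perm.mul_apply, hval, Equiv.swap_apply_left, e3]
      simp only [Units.val_neg, Int.cast_neg]
      ring
  have hcard : ((Fintype.card ι : 𝕜) + 1) ≠ 0 := by
    exact_mod_cast Nat.succ_ne_zero (Fintype.card ι)
  have hfac : ((Fintype.card ι).factorial : 𝕜) ≠ 0 := by
    exact_mod_cast Nat.factorial_ne_zero (Fintype.card ι)
  unfold pf
  rw [sum_pfTerm_eq A hskew v none, key, Fintype.card_option, Nat.factorial_succ, pow_succ]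
  push_cast
  simp_rw [mul_left_comm (A _ _), ← Finset.mul_sum]
  rw [← mul_sub]
  simp only [hu]
  field_simp

end Algebra

/-! ### Pfaffians of sets of pairs of rows -/

section Restricted

variable {𝕜 : Type*} [Field 𝕜] {W : Type*} {ι : Type*}

/-- The vertices in the slots of the pairs in `K`. -/
def slotVertices [DecidableEq W] (v : ι × Bool → W) (K : Finset ι) : Finset W :=
  (K ×ˢ Finset.univ).image v

theorem mem_slotVertices [DecidableEq W] {v : ι × Bool → W} {K : Finset ι} {w : W} :
    w ∈ slotVertices v K ↔ ∃ s, s.1 ∈ K ∧ v s = w := by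
  simp [slotVertices]

theorem apply_mem_slotVertices [DecidableEq W] {v : ι × Bool → W} (hv : Function.Injective v)
    {K : Finset ι} {s : ι × Bool} : v s ∈ slotVertices v K ↔ s.1 ∈ K := by
  rw [mem_slotVertices]
  exact ⟨fun ⟨t, ht, h⟩ => hv h ▸ ht, fun h => ⟨s, h, rfl⟩⟩

variable [DecidableEq ι]

/-- The Pfaffian of the rows belonging to the pairs in `K`. -/
def subPf (A : Matrix W W 𝕜) (v : ι × Bool → W) (K : Finset ι) : 𝕜 :=
  pf A fun x : K × Bool => v (x.1, x.2)

theorem subPf_congr (A : Matrix W W 𝕜) {v v' : ι × Bool → W} {K : Finset ι}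
    (h : ∀ x : ι × Bool, x.1 ∈ K → v x = v' x) : subPf A v K = subPf A v' K := by
  unfold subPf
  congr 1
  funext x
  exact h _ x.1.2

theorem subPf_univ [Fintype ι] (A : Matrix W W 𝕜) (v : ι × Bool → W) : subPf A v Finset.univ = pf A v :=
  pf_reindex A (Equiv.subtypeUnivEquiv fun i : ι => Finset.mem_univ i) v

theorem subPf_empty (A : Matrix W W 𝕜) (v : ι × Bool → W) : subPf A v ∅ = 1 := by
  simp [subPf, pf, pfTerm]

theorem subPf_expand [CharZero 𝕜] (A : Matrix W W 𝕜) (hskew : ∀ i j, A i j = -A j i)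
    (v : ι × Bool → W) {K : Finset ι} {k : ι} (hk : k ∈ K) :
    subPf A v K = A (v (k, false)) (v (k, true)) * subPf A v (K.erase k) -
      ∑ s ∈ K.erase k ×ˢ Finset.univ, A (v (k, false)) (v s) *
        subPf A (Function.update v s (v (k, true))) (K.erase k) := by
  have hk' : k ∉ K.erase k := Finset.notMem_erase k K
  conv_lhs => rw [← Finset.insert_erase hk]
  unfold subPf
  rw [← pf_reindex A (Finset.subtypeInsertEquivOption hk').symm, pf_option A hskew]
  congr 1
  rw [Fintype.sum_prod_type, Finset.sum_product, ← Finset.sum_coe_sort (K.erase k)]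
  refine Finset.sum_congr rfl fun i _ => Finset.sum_congr rfl fun b _ => ?_
  change A (v (k, false)) (v (i, b)) * _ = _
  congr 2
  funext x
  by_cases hx : x = (i, b)
  · subst hx
    simp only [Function.update_self]
    rfl
  · have hx' : ((x.1 : ι), x.2) ≠ ((i : ι), b) := fun h => hx (by
      rw [Prod.mk.injEq] at h
      exact Prod.ext (Subtype.ext h.1) h.2)
    rw [Function.update_of_ne hx, Function.update_of_ne hx']
    rfl

/-- The sign of using a pair with the orientation from `x` to its mate. -/
def slotSign (x : ι × Bool) : ℤˣ := if x.2 then -1 else 1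

theorem subPf_swap (A : Matrix W W 𝕜) (v : ι × Bool → W) {K : Finset ι} {k : ι} (hk : k ∈ K) :
    subPf A (v ∘ Equiv.swap (k, false) (k, true)) K = -subPf A v K := by
  unfold subPf
  have h := pf_comp_perm A (fun x : K × Bool => v (x.1, x.2))
    (Equiv.swap (⟨k, hk⟩, false) (⟨k, hk⟩, true))
  rw [Equiv.Perm.sign_swap (by simp)] at h
  simp only [Units.val_neg, Units.val_one, Int.cast_neg, Int.cast_one, neg_mul, one_mul] at h
  rw [← h]
  congr 1
  funext x
  simp only [Function.comp_apply, Equiv.swap_apply_def]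
  obtain ⟨⟨i, hi⟩, b⟩ := x
  simp only [Prod.mk.injEq, Subtype.mk.injEq]
  split_ifs <;> rfl

/-- Replace the vertex in slot `x` by `w` and expand along the row of the mate `y` of `x`: either
`y` is matched with `w`, or it is matched with another row `s`, and `w` takes the place of `s`. -/
theorem subPf_update [CharZero 𝕜] (A : Matrix W W 𝕜) (hskew : ∀ i j, A i j = -A j i)
    (v : ι × Bool → W) {K : Finset ι} {x : ι × Bool} (hx : x.1 ∈ K) (w : W) :
    -subPf A (Function.update v x w) K = ((slotSign x : ℤ) : 𝕜) *
      (A (v (mate x)) w * subPf A v (K.erase x.1) +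
        ∑ s ∈ K.erase x.1 ×ˢ Finset.univ, A (v (mate x)) (v s) *
          -subPf A (Function.update v s w) (K.erase x.1)) := by
  have key : ∀ g : ι × Bool → W, g (x.1, false) = v (mate x) → g (x.1, true) = w →
      (∀ s : ι × Bool, s.1 ∈ K.erase x.1 → g s = v s) →
      subPf A g K = A (v (mate x)) w * subPf A v (K.erase x.1) +
        ∑ s ∈ K.erase x.1 ×ˢ Finset.univ, A (v (mate x)) (v s) *
          -subPf A (Function.update v s w) (K.erase x.1) := by
    intro g h0 h1 h2
    rw [subPf_expand A hskew g hx, h0, h1, subPf_congr A h2, sub_eq_add_neg,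
      ← Finset.sum_neg_distrib]
    congr 1
    refine Finset.sum_congr rfl fun s hs => ?_
    rw [h2 s (Finset.mem_product.mp hs).1, mul_neg]
    congr 2
    refine subPf_congr A fun t ht => ?_
    by_cases hts : t = s
    · rw [hts, Function.update_self, Function.update_self]
    · rw [Function.update_of_ne hts, Function.update_of_ne hts, h2 t ht]
  have hrest : ∀ s : ι × Bool, s.1 ∈ K.erase x.1 → Function.update v x w s = v s :=
    fun s hs => Function.update_of_ne (fun h => Finset.ne_of_mem_erase hs (by rw [h])) _ _
  obtain ⟨k, b⟩ := x
  have hmate : mate (k, b) ≠ (k, b) := mate_ne _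
  cases b
  · rw [← subPf_swap A _ hx, key]
    · simp [slotSign]
    · rw [Function.comp_apply, Equiv.swap_apply_left, Function.update_of_ne (by simp)]
      rfl
    · rw [Function.comp_apply, Equiv.swap_apply_right, Function.update_self]
    · intro s hs
      rw [Function.comp_apply, Equiv.swap_apply_of_ne_of_ne, hrest s hs]
      · exact fun h => Finset.ne_of_mem_erase hs (by rw [h])
      · exact fun h => Finset.ne_of_mem_erase hs (by rw [h])
  · rw [key _ (Function.update_of_ne hmate _ _) (Function.update_self _ _ _) hrest]
    simp [slotSign]

/-- As the rows sum to zero, a row of the Pfaffian may be traded for the rows outside `K`. -/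
theorem subPf_eq_neg_sum [CharZero 𝕜] [Fintype W] [DecidableEq W] (A : Matrix W W 𝕜)
    (hskew : ∀ i j, A i j = -A j i) (hsum : ∀ i, ∑ j, A i j = 0) {v : ι × Bool → W}
    (hv : Function.Injective v) {K : Finset ι} {x : ι × Bool} (hx : x.1 ∈ K) :
    subPf A v K = -∑ w ∈ (slotVertices v K)ᶜ, subPf A (Function.update v x w) K := by
  have hupd : ∀ w, pf A (Function.update (fun y : K × Bool => v (y.1, y.2)) (⟨x.1, hx⟩, x.2) w) =
      subPf A (Function.update v x w) K := fun w => by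
    unfold subPf
    congr 1
    funext y
    by_cases hy : y = (⟨x.1, hx⟩, x.2)
    · subst hy; simp
    · have hy' : ((y.1 : ι), y.2) ≠ x := fun h => hy (by subst h; rfl)
      rw [Function.update_of_ne hy, Function.update_of_ne hy']
  have h0 := sum_pf_update A hskew hsum (fun y : K × Bool => v (y.1, y.2)) (⟨x.1, hx⟩, x.2)
  simp_rw [hupd] at h0
  rw [← Finset.sum_compl_add_sum (slotVertices v K)] at h0
  have h1 : ∑ w ∈ slotVertices v K, subPf A (Function.update v x w) K = subPf A v K := by
    rw [Finset.sum_eq_single_of_mem (v x) ((apply_mem_slotVertices hv).mpr hx),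
      Function.update_eq_self]
    intro w hw hne
    obtain ⟨s, hs, rfl⟩ := mem_slotVertices.mp hw
    have hsx : s ≠ x := fun h => hne (by rw [h])
    refine pf_eq_zero_of_eq A _ (s := (⟨s.1, hs⟩, s.2)) (t := (⟨x.1, hx⟩, x.2)) ?_ ?_
    · intro h
      simp only [Prod.mk.injEq, Subtype.mk.injEq] at h
      exact hsx (Prod.ext h.1 h.2)
    · simp [Function.update_of_ne hsx]
  rw [h1] at h0
  exact eq_neg_of_add_eq_zero_right h0

end Restricted

/-! ### Growing forests path by path -/

section Weight

variable {W : Type*} {ι : Type*} {𝕜 : Type*} [Field 𝕜]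

open Classical in
/-- The weight of an oriented edge: a sign recording the orientation on the edges within a pair,
and the matrix entry on the other edges. -/
noncomputable def edgeWeight (A : Matrix W W 𝕜) (v : ι × Bool → W) (e : W × W) : 𝕜 :=
  if h : ∃ x, e = (v x, v (mate x)) then ((slotSign h.choose : ℤ) : 𝕜) else A e.1 e.2

theorem edgeWeight_mate (A : Matrix W W 𝕜) {v : ι × Bool → W} (hv : Function.Injective v)
    (x : ι × Bool) : edgeWeight A v (v x, v (mate x)) = ((slotSign x : ℤ) : 𝕜) := by
  have h : ∃ y, (v x, v (mate x)) = (v y, v (mate y)) := ⟨x, rfl⟩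
  have hx : x = h.choose := hv (congrArg Prod.fst h.choose_spec)
  rw [edgeWeight, dif_pos h, ← hx]

theorem edgeWeight_of_ne (A : Matrix W W 𝕜) {v : ι × Bool → W} {e : W × W}
    (h : ∀ x, e ≠ (v x, v (mate x))) : edgeWeight A v e = A e.1 e.2 :=
  dif_neg fun ⟨x, hx⟩ => h x hx

/-- The two edges by which a path leaves a pair can be recovered from the grown forest. -/
theorem insert_insert_injective [DecidableEq W] [DecidableEq ι] {v : ι × Bool → W} (hv : Function.Injective v) {K : Finset ι}
    {x : ι × Bool} {w w' : W} {F F' : Finset (W × W)}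
    (hF : ∀ e ∈ F, e.1 ∈ slotVertices v (K.erase x.1))
    (hF' : ∀ e ∈ F', e.1 ∈ slotVertices v (K.erase x.1))
    (h : insert (v x, v (mate x)) (insert (v (mate x), w) F) =
      insert (v x, v (mate x)) (insert (v (mate x), w') F')) : w = w' ∧ F = F' := by
  have hx : ∀ y : ι × Bool, y.1 = x.1 → v y ∉ slotVertices v (K.erase x.1) := fun y hy h => by
    rw [apply_mem_slotVertices hv, hy] at h
    exact Finset.notMem_erase _ _ h
  have hne : v (mate x) ≠ v x := fun h => mate_ne x (hv h)
  constructor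
  · have h1 : (v (mate x), w) ∈ insert (v x, v (mate x)) (insert (v (mate x), w') F') := by
      rw [← h]; simp
    rcases Finset.mem_insert.mp h1 with h1 | h1
    · exact absurd (congrArg Prod.fst h1) hne
    rcases Finset.mem_insert.mp h1 with h1 | h1
    · exact congrArg Prod.snd h1
    · exact absurd (hF' _ h1) (hx _ rfl)
  · have hfilter : ∀ (z : W) (G : Finset (W × W)),
        (∀ e ∈ G, e.1 ∈ slotVertices v (K.erase x.1)) →
        (insert (v x, v (mate x)) (insert (v (mate x), z) G)).filter
          (fun e => e.1 ∈ slotVertices v (K.erase x.1)) = G := by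
      intro z G hG
      rw [Finset.filter_insert, if_neg (hx x rfl), Finset.filter_insert,
        if_neg (hx (mate x) rfl), Finset.filter_true_of_mem hG]
    rw [← hfilter w F hF, h, hfilter w' F' hF']

end Weight

section Growth

variable {W : Type*} [LinearOrder W] [Fintype W] {ι : Type*} [DecidableEq ι] {𝕜 : Type*} [Field 𝕜]

/-- The forests that are grown, path by path, on the pairs in `K`. In the mode `none` no path is
under construction, and the next one starts at the smallest vertex that is left. In the mode
`some (T, x)` a path has arrived at the slot `x`; it uses the edge to the mate of `x` and one
further edge, by which it either ends in `T` or moves on to a pair that is left. Every path ends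
at the first vertex not available when it started. -/
inductive Grows (v : ι × Bool → W) :
    Finset ι → Option (Finset W × (ι × Bool)) → Finset (W × W) → Prop
  | nil : Grows v ∅ none ∅
  | start (K : Finset ι) (x : ι × Bool) (F : Finset (W × W)) : x.1 ∈ K →
      (∀ s : ι × Bool, s.1 ∈ K → v x ≤ v s) → Grows v K (some ((slotVertices v K)ᶜ, x)) F →
      Grows v K none F
  | close (K : Finset ι) (T : Finset W) (x : ι × Bool) (w : W) (F : Finset (W × W)) : x.1 ∈ K →
      w ∈ T → Grows v (K.erase x.1) none F →
      Grows v K (some (T, x)) (insert (v x, v (mate x)) (insert (v (mate x), w) F))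
  | move (K : Finset ι) (T : Finset W) (x s : ι × Bool) (F : Finset (W × W)) : x.1 ∈ K →
      s.1 ∈ K.erase x.1 → Grows v (K.erase x.1) (some (T, s)) F →
      Grows v K (some (T, x)) (insert (v x, v (mate x)) (insert (v (mate x), v s) F))

theorem Grows.fst_mem {v : ι × Bool → W} {K : Finset ι} {m : Option (Finset W × (ι × Bool))}
    {F : Finset (W × W)} (h : Grows v K m F) : ∀ e ∈ F, e.1 ∈ slotVertices v K := by
  have mono : ∀ {K : Finset ι} {i : ι} {w : W}, w ∈ slotVertices v (K.erase i) →
      w ∈ slotVertices v K := by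
    intro K i w hw
    obtain ⟨s, hs, rfl⟩ := mem_slotVertices.mp hw
    exact mem_slotVertices.mpr ⟨s, Finset.mem_of_mem_erase hs, rfl⟩
  induction h with
  | nil => simp
  | start K x F hx hmin hF ih => exact ih
  | close K T x w F hx hw hF ih =>
    intro e he
    rcases Finset.mem_insert.mp he with rfl | he
    · exact mem_slotVertices.mpr ⟨x, hx, rfl⟩
    rcases Finset.mem_insert.mp he with rfl | he
    · exact mem_slotVertices.mpr ⟨mate x, hx, rfl⟩
    · exact mono (ih e he)
  | move K T x s F hx hs hF ih =>
    intro e he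
    rcases Finset.mem_insert.mp he with rfl | he
    · exact mem_slotVertices.mpr ⟨x, hx, rfl⟩
    rcases Finset.mem_insert.mp he with rfl | he
    · exact mem_slotVertices.mpr ⟨mate x, hx, rfl⟩
    · exact mono (ih e he)

open Classical in
/-- The weighted sum over the forests grown from a path under construction, in terms of the
continuations of that path by one pair. -/
theorem sum_grows_some (A : Matrix W W 𝕜) {v : ι × Bool → W} (hv : Function.Injective v)
    {K : Finset ι} {T : Finset W} {x : ι × Bool} (hx : x.1 ∈ K)
    (hT : Disjoint T (slotVertices v K)) :
    ∑ F with Grows v K (some (T, x)) F, ∏ e ∈ F, edgeWeight A v e =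
      ((slotSign x : ℤ) : 𝕜) *
        (∑ w ∈ T, A (v (mate x)) w *
            ∑ F with Grows v (K.erase x.1) none F, ∏ e ∈ F, edgeWeight A v e +
          ∑ s ∈ K.erase x.1 ×ˢ Finset.univ, A (v (mate x)) (v s) *
            ∑ F with Grows v (K.erase x.1) (some (T, s)) F, ∏ e ∈ F, edgeWeight A v e) := by
  set K' := K.erase x.1 with hK'
  set ins : W → Finset (W × W) → Finset (W × W) := fun w F =>
    insert (v x, v (mate x)) (insert (v (mate x), w) F) with hins
  set next : W → Finset (Finset (W × W)) := fun w => Finset.univ.filter fun F =>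
    (w ∈ T ∧ Grows v K' none F) ∨ ∃ s : ι × Bool, s.1 ∈ K' ∧ v s = w ∧
      Grows v K' (some (T, s)) F with hnext
  have hsub : ∀ w, w ∈ slotVertices v K' → w ∈ slotVertices v K := fun w hw => by
    obtain ⟨s, hs, rfl⟩ := mem_slotVertices.mp hw
    exact mem_slotVertices.mpr ⟨s, Finset.mem_of_mem_erase hs, rfl⟩
  have hT' : Disjoint T (slotVertices v K') :=
    Finset.disjoint_left.mpr fun w h1 h2 => Finset.disjoint_left.mp hT h1 (hsub w h2)
  have hfst : ∀ w, ∀ F ∈ next w, ∀ e ∈ F, e.1 ∈ slotVertices v K' := by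
    intro w F hF
    rcases (Finset.mem_filter.mp hF).2 with ⟨_, h⟩ | ⟨s, _, _, h⟩
    · exact h.fst_mem
    · exact h.fst_mem
  have hset : Finset.univ.filter (fun F => Grows v K (some (T, x)) F) =
      (T ∪ slotVertices v K').biUnion fun w => (next w).image (ins w) := by
    ext F
    simp only [Finset.mem_filter, Finset.mem_univ, true_and, Finset.mem_biUnion,
      Finset.mem_image, Finset.mem_union]
    constructor
    · rintro (_ | _ | ⟨_, _, _, w, F, _, hw, hF⟩ | ⟨_, _, _, s, F, _, hs, hF⟩)
      · exact ⟨w, Or.inl hw, F, Finset.mem_filter.mpr ⟨Finset.mem_univ _, Or.inl ⟨hw, hF⟩⟩, rfl⟩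
      · exact ⟨v s, Or.inr (mem_slotVertices.mpr ⟨s, hs, rfl⟩), F,
          Finset.mem_filter.mpr ⟨Finset.mem_univ _, Or.inr ⟨s, hs, rfl, hF⟩⟩, rfl⟩
    · rintro ⟨w, -, F, hF, rfl⟩
      rcases (Finset.mem_filter.mp hF).2 with ⟨hw, hF'⟩ | ⟨s, hs, rfl, hF'⟩
      · exact Grows.close K T x w F hx hw hF'
      · exact Grows.move K T x s F hx hs hF'
  have hprod : ∀ w ∈ T ∪ slotVertices v K', ∀ F ∈ next w, ∏ e ∈ ins w F, edgeWeight A v e =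
      ((slotSign x : ℤ) : 𝕜) * (A (v (mate x)) w * ∏ e ∈ F, edgeWeight A v e) := by
    intro w hw F hF
    have hout : ∀ y : ι × Bool, y.1 = x.1 → ∀ z, (v y, z) ∉ F := fun y hy z h => by
      have := hfst w F hF _ h
      rw [apply_mem_slotVertices hv, hy] at this
      exact Finset.notMem_erase _ _ this
    have hwx : w ≠ v x := by
      rintro rfl
      rcases Finset.mem_union.mp hw with hw | hw
      · exact Finset.disjoint_left.mp hT hw ((apply_mem_slotVertices hv).mpr hx)
      · exact Finset.notMem_erase _ _ ((apply_mem_slotVertices hv).mp hw)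
    rw [hins, Finset.prod_insert, Finset.prod_insert (hout (mate x) rfl w), edgeWeight_mate A hv,
      edgeWeight_of_ne]
    · intro s hs
      rw [Prod.mk.injEq] at hs
      have hxs := hv hs.1
      rw [← hxs, mate_mate] at hs
      exact hwx hs.2
    · intro h
      rcases Finset.mem_insert.mp h with h | h
      · exact mate_ne x (hv (congrArg Prod.fst h)).symm
      · exact hout _ rfl _ h
  rw [hset, Finset.sum_biUnion]
  · have hsum : ∀ w ∈ T ∪ slotVertices v K',
        ∑ F ∈ (next w).image (ins w), ∏ e ∈ F, edgeWeight A v e =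
        ((slotSign x : ℤ) : 𝕜) *
          (A (v (mate x)) w * ∑ F ∈ next w, ∏ e ∈ F, edgeWeight A v e) := by
      intro w hw
      rw [Finset.sum_image, Finset.sum_congr rfl (hprod w hw), ← Finset.mul_sum, ← Finset.mul_sum]
      intro F hF F' hF' h
      exact (insert_insert_injective hv (hfst w F hF) (hfst w F' hF') h).2
    rw [Finset.sum_congr rfl hsum, ← Finset.mul_sum, Finset.sum_union hT', slotVertices,
      Finset.sum_image hv.injOn]
    congr 2
    · refine Finset.sum_congr rfl fun w hw => ?_
      congr 2
      refine Finset.filter_congr fun F _ => ?_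
      refine ⟨?_, fun h => Or.inl ⟨hw, h⟩⟩
      rintro (⟨-, h⟩ | ⟨s, hs, rfl, -⟩)
      · exact h
      · exact absurd (mem_slotVertices.mpr ⟨s, hs, rfl⟩) (Finset.disjoint_left.mp hT' hw)
    · refine Finset.sum_congr rfl fun s hs => ?_
      have hs := (Finset.mem_product.mp hs).1
      congr 2
      refine Finset.filter_congr fun F _ => ?_
      refine ⟨?_, fun h => Or.inr ⟨s, hs, rfl, h⟩⟩
      rintro (⟨hw, -⟩ | ⟨s', hs', h, hF⟩)
      · exact absurd (mem_slotVertices.mpr ⟨s, hs, rfl⟩) (Finset.disjoint_left.mp hT' hw)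
      · exact hv h ▸ hF
  · intro w _ w' _ hne
    refine Finset.disjoint_left.mpr fun G hG hG' => hne ?_
    obtain ⟨F, hF, rfl⟩ := Finset.mem_image.mp hG
    obtain ⟨F', hF', h⟩ := Finset.mem_image.mp hG'
    exact (insert_insert_injective hv (hfst _ F' hF') (hfst _ F hF) h).1.symm

open Classical in
/-- The Pfaffian is the weighted sum over the grown forests. In the course of a path, the sum is
the value of the Pfaffian after the rows outside have taken the place of the row where the path
has arrived: the expansion along the mate of that row is one move of the path. -/
theorem sum_grows [CharZero 𝕜] (A : Matrix W W 𝕜) (hskew : ∀ i j, A i j = -A j i)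
    (hsum : ∀ i, ∑ j, A i j = 0) {v : ι × Bool → W} (hv : Function.Injective v) (K : Finset ι) :
    (∑ F with Grows v K none F, ∏ e ∈ F, edgeWeight A v e = subPf A v K) ∧
    ∀ (T : Finset W) (x : ι × Bool), x.1 ∈ K → Disjoint T (slotVertices v K) →
      ∑ F with Grows v K (some (T, x)) F, ∏ e ∈ F, edgeWeight A v e =
        ∑ w ∈ T, -subPf A (Function.update v x w) K := by
  induction h : K.card generalizing K with
  | zero =>
    obtain rfl := Finset.card_eq_zero.mp h
    refine ⟨?_, fun T x hx => absurd hx (Finset.notMem_empty _)⟩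
    have hnil : Finset.univ.filter (fun F => Grows v ∅ none F) = {∅} := by
      ext F
      simp only [Finset.mem_filter, Finset.mem_univ, true_and, Finset.mem_singleton]
      constructor
      · rintro (_ | ⟨_, x, _, hx⟩)
        · rfl
        · exact absurd hx (Finset.notMem_empty _)
      · rintro rfl
        exact Grows.nil
    rw [hnil, Finset.sum_singleton, Finset.prod_empty, subPf_empty]
  | succ n ih =>
    have hsome : ∀ (T : Finset W) (x : ι × Bool), x.1 ∈ K → Disjoint T (slotVertices v K) →
        ∑ F with Grows v K (some (T, x)) F, ∏ e ∈ F, edgeWeight A v e =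
          ∑ w ∈ T, -subPf A (Function.update v x w) K := by
      intro T x hx hT
      obtain ⟨ih1, ih2⟩ := ih (K.erase x.1) (by rw [Finset.card_erase_of_mem hx, h]; rfl)
      have hT' : Disjoint T (slotVertices v (K.erase x.1)) :=
        Finset.disjoint_left.mpr fun w h1 h2 => by
          obtain ⟨s, hs, rfl⟩ := mem_slotVertices.mp h2
          exact Finset.disjoint_left.mp hT h1
            (mem_slotVertices.mpr ⟨s, Finset.mem_of_mem_erase hs, rfl⟩)
      simp_rw [sum_grows_some A hv hx hT, ih1, subPf_update A hskew v hx]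
      rw [← Finset.mul_sum, Finset.sum_add_distrib]
      congr 2
      rw [Finset.sum_comm]
      refine Finset.sum_congr rfl fun s hs => ?_
      rw [ih2 T s (Finset.mem_product.mp hs).1 hT', Finset.mul_sum]
    refine ⟨?_, hsome⟩
    obtain ⟨i, hi⟩ := Finset.card_pos.mp (by omega : 0 < K.card)
    obtain ⟨x, hx, hmin⟩ := Finset.exists_min_image (K ×ˢ Finset.univ) v
      ⟨(i, false), Finset.mem_product.mpr ⟨hi, Finset.mem_univ _⟩⟩
    have hx := (Finset.mem_product.mp hx).1
    have hmin : ∀ s : ι × Bool, s.1 ∈ K → v x ≤ v s := fun s hs =>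
      hmin s (Finset.mem_product.mpr ⟨hs, Finset.mem_univ _⟩)
    have hstart : ∀ F, Grows v K none F ↔ Grows v K (some ((slotVertices v K)ᶜ, x)) F := by
      intro F
      refine ⟨?_, Grows.start K x F hx hmin⟩
      rintro (_ | ⟨_, y, _, hy, hmin', hF⟩)
      · exact absurd hx (Finset.notMem_empty _)
      · exact hv (le_antisymm (hmin y hy) (hmin' x hx)) ▸ hF
    simp_rw [hstart]
    rw [hsome _ x hx disjoint_compl_left, subPf_eq_neg_sum A hskew hsum hv hx,
      Finset.sum_neg_distrib]

end Growth

/-! ### Edges of a path -/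

section Paths

variable {N : ℕ}

theorem pathEdges_cons_cons (a b : Fin N) (l : List (Fin N)) :
    pathEdges (a :: b :: l) = (a, b) :: pathEdges (b :: l) := rfl

theorem length_pathEdges (a : Fin N) (l : List (Fin N)) :
    (pathEdges (a :: l)).length = l.length := by
  simp [pathEdges]

theorem snd_mem_of_mem_pathEdges {a b c : Fin N} {l : List (Fin N)}
    (h : (a, b) ∈ pathEdges (c :: l)) : b ∈ l :=
  (List.of_mem_zip h).2

theorem fst_mem_of_mem_pathEdges {a b c w : Fin N} {q : List (Fin N)}
    (h : (a, b) ∈ pathEdges (c :: (q ++ [w]))) : a ∈ c :: q := by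
  induction q generalizing c with
  | nil => simp_all [pathEdges]
  | cons d q ih =>
    rw [List.cons_append, pathEdges_cons_cons] at h
    rcases List.mem_cons.mp h with h | h
    · simp_all
    · exact List.mem_cons_of_mem _ (ih h)

theorem exists_mem_pathEdges_of_mem_tail {b c : Fin N} {l : List (Fin N)} (h : b ∈ l) :
    ∃ a, (a, b) ∈ pathEdges (c :: l) := by
  induction l generalizing c with
  | nil => simp at h
  | cons d l ih =>
    rw [pathEdges_cons_cons]
    rcases List.mem_cons.mp h with rfl | h
    · exact ⟨c, List.mem_cons_self⟩
    · obtain ⟨a, ha⟩ := ih (c := d) h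
      exact ⟨a, List.mem_cons_of_mem _ ha⟩

theorem exists_mem_pathEdges_of_mem {a c w : Fin N} {q : List (Fin N)} (h : a ∈ c :: q) :
    ∃ b, (a, b) ∈ pathEdges (c :: (q ++ [w])) := by
  induction q generalizing c with
  | nil => exact ⟨w, by simp_all [pathEdges]⟩
  | cons d q ih =>
    rw [List.cons_append, pathEdges_cons_cons]
    rcases List.mem_cons.mp h with rfl | h
    · exact ⟨d, List.mem_cons_self⟩
    · obtain ⟨b, hb⟩ := ih h
      exact ⟨b, List.mem_cons_of_mem _ hb⟩

theorem pathEdges_target_unique {p : List (Fin N)} (hp : p.Nodup) {a b b' : Fin N}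
    (h : (a, b) ∈ pathEdges p) (h' : (a, b') ∈ pathEdges p) : b = b' := by
  induction p with
  | nil => simp [pathEdges] at h
  | cons c l ih =>
    cases l with
    | nil => simp [pathEdges] at h
    | cons d l =>
      have hc : ∀ z, (c, z) ∉ pathEdges (d :: l) := fun z hz =>
        (List.nodup_cons.mp hp).1 (List.of_mem_zip hz).1
      rw [pathEdges_cons_cons] at h h'
      rcases List.mem_cons.mp h with h | h <;> rcases List.mem_cons.mp h' with h' | h'
      · rw [(Prod.mk.inj h).2, (Prod.mk.inj h').2]
      · rw [(Prod.mk.inj h).1] at h'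
        exact absurd h' (hc _)
      · rw [(Prod.mk.inj h').1] at h
        exact absurd h (hc _)
      · exact ih (List.nodup_cons.mp hp).2 h h'

theorem pathEdges_source_unique {p : List (Fin N)} (hp : p.Nodup) {a a' b : Fin N}
    (h : (a, b) ∈ pathEdges p) (h' : (a', b) ∈ pathEdges p) : a = a' := by
  induction p with
  | nil => simp [pathEdges] at h
  | cons c l ih =>
    cases l with
    | nil => simp [pathEdges] at h
    | cons d l =>
      have hd : ∀ z, (z, d) ∉ pathEdges (d :: l) := fun z hz =>
        (List.nodup_cons.mp (List.nodup_cons.mp hp).2).1 (snd_mem_of_mem_pathEdges hz)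
      rw [pathEdges_cons_cons] at h h'
      rcases List.mem_cons.mp h with h | h <;> rcases List.mem_cons.mp h' with h' | h'
      · rw [(Prod.mk.inj h).1, (Prod.mk.inj h').1]
      · rw [(Prod.mk.inj h).2] at h'
        exact absurd h' (hd _)
      · rw [(Prod.mk.inj h').2] at h
        exact absurd h (hd _)
      · exact ih (List.nodup_cons.mp hp).2 h h'

/-- There is no oriented cycle. -/
def Acyclic (F : OrientedEdges N) : Prop :=
  ∀ a, ¬ Relation.TransGen (fun b c => (b, c) ∈ F) a a

theorem Acyclic.mono {F F' : OrientedEdges N} (hF : Acyclic F) (h : F' ⊆ F) : Acyclic F' :=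
  fun a ha => hF a (ha.lift id fun _ _ hbc => h hbc)

theorem Acyclic.nodup {F : OrientedEdges N} (hF : Acyclic F) {p : List (Fin N)}
    (hp : ∀ e ∈ pathEdges p, e ∈ F) : p.Nodup := by
  have key : ∀ (l : List (Fin N)) (a : Fin N), (∀ e ∈ pathEdges (a :: l), e ∈ F) →
      ∀ z ∈ l, Relation.TransGen (fun b c => (b, c) ∈ F) a z := by
    intro l
    induction l with
    | nil => simp
    | cons d l ih =>
      intro a ha z hz
      rw [pathEdges_cons_cons, List.forall_mem_cons] at ha
      rcases List.mem_cons.mp hz with rfl | hz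
      · exact Relation.TransGen.single ha.1
      · exact Relation.TransGen.head ha.1 (ih d ha.2 z hz)
  induction p with
  | nil => exact List.nodup_nil
  | cons a l ih =>
    refine List.nodup_cons.mpr ⟨fun h => hF a (key l a hp a h), ?_⟩
    cases l with
    | nil => exact List.nodup_nil
    | cons d l =>
      rw [pathEdges_cons_cons, List.forall_mem_cons] at hp
      exact ih hp.2

/-- A new edge that starts at a vertex without incoming edges closes no cycle. -/
theorem Acyclic.insert_edge {F : OrientedEdges N} (hF : Acyclic F) {a b : Fin N} (hab : a ≠ b)
    (ha : ∀ c, (c, a) ∉ F) : Acyclic (insert (a, b) F) := by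
  have key : ∀ c d, c ≠ a → Relation.TransGen (fun b' c' => (b', c') ∈ insert (a, b) F) c d →
      Relation.TransGen (fun b' c' => (b', c') ∈ F) c d ∧ d ≠ a := by
    intro c d hc h
    have hne : ∀ {x y}, x ≠ a → (x, y) ∈ insert (a, b) F → (x, y) ∈ F ∧ y ≠ a := by
      intro x y hx hxy
      rcases Finset.mem_insert.mp hxy with h | h
      · exact absurd (Prod.mk.inj h).1 hx
      · exact ⟨h, fun hy => ha x (hy ▸ h)⟩
    induction h with
    | single h => exact ⟨Relation.TransGen.single (hne hc h).1, (hne hc h).2⟩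
    | tail _ h ih => exact ⟨ih.1.tail (hne ih.2 h).1, (hne ih.2 h).2⟩
  intro c hc
  by_cases hca : c = a
  · subst hca
    obtain ⟨d, hd, hdc⟩ := Relation.TransGen.tail'_iff.mp hc
    by_cases hdc' : d = c
    · subst hdc'
      rcases Finset.mem_insert.mp hdc with h | h
      · exact hab (Prod.mk.inj h).2
      · exact ha _ h
    · exact (key d c hdc' (Relation.TransGen.single hdc)).2 rfl
  · exact hF c (key c c hca hc).1

theorem Acyclic.union_path {F : OrientedEdges N} (hF : Acyclic F) {a w : Fin N}
    {q : List (Fin N)} (hp : (a :: (q ++ [w])).Nodup)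
    (hin : ∀ b ∈ a :: q, ∀ c, (c, b) ∉ F) :
    Acyclic (F ∪ (pathEdges (a :: (q ++ [w]))).toFinset) := by
  induction q generalizing a with
  | nil =>
    have : F ∪ (pathEdges (a :: ([] ++ [w]))).toFinset = insert (a, w) F := by
      ext e; simp [pathEdges, or_comm]
    rw [this]
    exact hF.insert_edge (by simpa using hp) (hin a List.mem_cons_self)
  | cons d q ih =>
    have h1 := ih (List.nodup_cons.mp hp).2 fun b hb => hin b (List.mem_cons_of_mem _ hb)
    have : F ∪ (pathEdges (a :: (d :: q ++ [w]))).toFinset =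
        insert (a, d) (F ∪ (pathEdges (d :: (q ++ [w]))).toFinset) := by
      rw [List.cons_append, pathEdges_cons_cons, List.toFinset_cons, Finset.union_insert]
    rw [this]
    refine h1.insert_edge (fun h => (List.nodup_cons.mp hp).1 (by simp [h])) fun c hc => ?_
    rcases Finset.mem_union.mp hc with hc | hc
    · exact hin a List.mem_cons_self c hc
    · exact (List.nodup_cons.mp hp).1
        (List.mem_cons_of_mem _ (snd_mem_of_mem_pathEdges (List.mem_toFinset.mp hc)))

end Paths

/-! ### Alternating paths -/

section Alternating

variable {N : ℕ} {ι : Type*} [DecidableEq ι]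

/-- `AltPath v D x q`: the list `v x :: q` runs through the pairs in `D`, each of them along its
edge, beginning with the edge from `x` to its mate. -/
inductive AltPath (v : ι × Bool → Fin N) : Finset ι → ι × Bool → List (Fin N) → Prop
  | last (x : ι × Bool) : AltPath v {x.1} x [v (mate x)]
  | cons (D : Finset ι) (x s : ι × Bool) (q : List (Fin N)) : x.1 ∉ D → AltPath v D s q →
      AltPath v (insert x.1 D) x (v (mate x) :: v s :: q)

variable {v : ι × Bool → Fin N} {D : Finset ι} {x : ι × Bool} {q : List (Fin N)}

theorem AltPath.start_mem (h : AltPath v D x q) : x.1 ∈ D := by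
  cases h <;> simp

theorem AltPath.mem_iff (h : AltPath v D x q) {a : Fin N} :
    a ∈ v x :: q ↔ a ∈ slotVertices v D := by
  rw [mem_slotVertices]
  induction h with
  | last x =>
    simp only [List.mem_cons, List.not_mem_nil, or_false, Finset.mem_singleton]
    constructor
    · rintro (rfl | rfl)
      · exact ⟨x, rfl, rfl⟩
      · exact ⟨mate x, rfl, rfl⟩
    · rintro ⟨s, hs, rfl⟩
      rcases eq_or_eq_mate hs with rfl | rfl <;> simp
  | cons D x s q hx h ih =>
    rw [List.mem_cons, List.mem_cons, ih]
    constructor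
    · rintro (rfl | rfl | ⟨t, ht, rfl⟩)
      · exact ⟨x, Finset.mem_insert_self _ _, rfl⟩
      · exact ⟨mate x, Finset.mem_insert_self _ _, rfl⟩
      · exact ⟨t, Finset.mem_insert_of_mem ht, rfl⟩
    · rintro ⟨t, ht, rfl⟩
      rcases Finset.mem_insert.mp ht with ht | ht
      · rcases eq_or_eq_mate ht with rfl | rfl <;> simp
      · exact Or.inr (Or.inr ⟨t, ht, rfl⟩)

theorem AltPath.nodup (hv : Function.Injective v) (h : AltPath v D x q) : (v x :: q).Nodup := by
  induction h with
  | last x => simpa using fun h => mate_ne x (hv h).symm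
  | cons D x s q hx h ih =>
    have hmem : ∀ y : ι × Bool, y.1 = x.1 → v y ∉ v s :: q := fun y hy hmem =>
      hx (hy ▸ (apply_mem_slotVertices hv).mp (h.mem_iff.mp hmem))
    refine List.nodup_cons.mpr ⟨fun h => ?_, List.nodup_cons.mpr ⟨hmem _ rfl, ih⟩⟩
    rcases List.mem_cons.mp h with h | h
    · exact mate_ne x (hv h).symm
    · exact hmem _ rfl h

theorem AltPath.even_length (h : AltPath v D x q) : Even (q.length + 1) := by
  induction h with
  | last x => exact even_two
  | cons D x s q hx h ih => simpa [Nat.even_add_one] using ih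

theorem AltPath.exists_cons (h : AltPath v D x q) : ∃ q', q = v (mate x) :: q' := by
  cases h <;> exact ⟨_, rfl⟩

theorem AltPath.exists_orientation (h : AltPath v D x q) (w : Fin N) :
    ∀ k ∈ D, ∃ y : ι × Bool, y.1 = k ∧ (v y, v (mate y)) ∈ pathEdges (v x :: (q ++ [w])) ∧
      ∃ z, (v (mate y), z) ∈ pathEdges (v x :: (q ++ [w])) := by
  induction h with
  | last x =>
    intro k hk
    exact ⟨x, (Finset.mem_singleton.mp hk).symm, by simp [pathEdges], w, by simp [pathEdges]⟩
  | cons D x s q hx h ih =>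
    intro k hk
    rw [List.cons_append, List.cons_append, pathEdges_cons_cons, pathEdges_cons_cons]
    rcases Finset.mem_insert.mp hk with rfl | hk
    · exact ⟨x, rfl, by simp, v s, by simp⟩
    · obtain ⟨y, hy, h1, z, h2⟩ := ih k hk
      exact ⟨y, hy, List.mem_cons_of_mem _ (List.mem_cons_of_mem _ h1), z,
        List.mem_cons_of_mem _ (List.mem_cons_of_mem _ h2)⟩

theorem AltPath.grows (h : AltPath v D x q) {T : Finset (Fin N)} {w : Fin N} (hw : w ∈ T)
    {K : Finset ι} (hK : ∀ k ∈ D, k ∉ K) {F : OrientedEdges N} (hF : Grows v K none F) :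
    Grows v (D ∪ K) (some (T, x)) ((pathEdges (v x :: (q ++ [w]))).toFinset ∪ F) := by
  induction h with
  | last x =>
    have hxK : x.1 ∉ K := hK _ (Finset.mem_singleton_self _)
    have h1 : (({x.1} : Finset ι) ∪ K).erase x.1 = K := by
      rw [← Finset.insert_eq, Finset.erase_insert hxK]
    have := Grows.close ({x.1} ∪ K) T x w F (by simp) hw (h1.symm ▸ hF)
    convert this using 1
    ext e
    simp [pathEdges]
  | cons D x s q hx h ih =>
    have hxK : x.1 ∉ K := hK _ (Finset.mem_insert_self _ _)
    have h1 : (insert x.1 D ∪ K).erase x.1 = D ∪ K := by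
      rw [Finset.insert_union, Finset.erase_insert (by simp [hx, hxK])]
    have h2 := ih fun k hk => hK k (Finset.mem_insert_of_mem hk)
    have := Grows.move (insert x.1 D ∪ K) T x s _ (by simp)
      (h1.symm ▸ Finset.mem_union_left _ h.start_mem) (h1.symm ▸ h2)
    convert this using 1
    rw [List.cons_append, List.cons_append, pathEdges_cons_cons, pathEdges_cons_cons,
      List.toFinset_cons, List.toFinset_cons, Finset.insert_union, Finset.insert_union]

theorem Grows.exists_altPath {K : Finset ι} {m : Option (Finset (Fin N) × (ι × Bool))}
    {F : OrientedEdges N} (h : Grows v K m F) {T : Finset (Fin N)} {x : ι × Bool}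
    (hm : m = some (T, x)) :
    ∃ D q w F', D ⊆ K ∧ AltPath v D x q ∧ w ∈ T ∧ Grows v (K \ D) none F' ∧
      F = F' ∪ (pathEdges (v x :: (q ++ [w]))).toFinset := by
  induction h generalizing x with
  | nil => simp at hm
  | start => simp at hm
  | close K T' y w F hy hw hF ih =>
    obtain ⟨rfl, rfl⟩ : T' = T ∧ y = x := by simpa using hm
    refine ⟨{y.1}, _, w, F, by simpa using hy, AltPath.last y, hw, ?_, ?_⟩
    · rwa [← Finset.erase_eq]
    · ext e; simp [pathEdges]
  | move K T' y s F hy hs hF ih =>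
    obtain ⟨rfl, rfl⟩ : T' = T ∧ y = x := by simpa using hm
    obtain ⟨D, q, w, F', hD, hq, hw, hF', rfl⟩ := ih rfl
    have hyD : y.1 ∉ D := fun h => Finset.notMem_erase _ _ (hD h)
    refine ⟨insert y.1 D, _, w, F', ?_, AltPath.cons D y s q hyD hq, hw, ?_, ?_⟩
    · exact Finset.insert_subset hy fun k hk => Finset.mem_of_mem_erase (hD hk)
    · convert hF' using 1
      ext k
      simp only [Finset.mem_sdiff, Finset.mem_insert, Finset.mem_erase]
      tauto
    · rw [List.cons_append, List.cons_append, pathEdges_cons_cons, pathEdges_cons_cons,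
        List.toFinset_cons, List.toFinset_cons, Finset.union_insert, Finset.union_insert]

end Alternating

/-! ### Trimming undoes the growth -/

section Trimming

variable {N : ℕ} {ι : Type*} {n : ℕ} {v : ι × Bool → Fin N}

/-- A stage common to the growth and the trimming of a forest: `F` is a forest on the pairs
outside `K` which contains one edge within each of these pairs, never enters a pair in `K`, and has
no leaf larger than a vertex of `K`. -/
structure IsStage (v : ι × Bool → Fin N) (F : OrientedEdges N) (K : Finset ι) : Prop where
  source : ∀ a b, (a, b) ∈ F → ∃ s : ι × Bool, s.1 ∉ K ∧ v s = a
  target_unique : ∀ a b b', (a, b) ∈ F → (a, b') ∈ F → b = b'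
  acyclic : Acyclic F
  orientation : ∀ k ∉ K, ∃ x : ι × Bool, x.1 = k ∧ (v x, v (mate x)) ∈ F ∧ ∃ z, (v (mate x), z) ∈ F
  target : ∀ a s, (a, v s) ∈ F → s.1 ∉ K
  leaf_lt : ∀ l, IsLeaf F l → ∀ s : ι × Bool, s.1 ∈ K → l < v s

/-- The path begins with an edge within a pair and has an even number of edges. -/
def IsGoodPath (v : ι × Bool → Fin N) (p : List (Fin N)) : Prop :=
  (∃ x, (pathEdges p).head? = some (v x, v (mate x))) ∧ Even (pathEdges p).length

theorem IsStage.exists_out {F : OrientedEdges N} {K : Finset ι} (h : IsStage v F K)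
    {s : ι × Bool} (hs : s.1 ∉ K) : ∃ z, (v s, z) ∈ F := by
  obtain ⟨x, hx, h1, h2⟩ := h.orientation s.1 hs
  rcases eq_or_eq_mate hx.symm with rfl | rfl
  · exact ⟨_, h1⟩
  · exact h2

variable [DecidableEq ι]

/-- A path of a forest that stops at no fork alternates between edges within pairs and other edges,
because each pair it enters elsewhere than at the source of its edge is a fork. -/
theorem IsStage.altPath_of_path (hv : Function.Injective v)
    (hroot : ∀ u : Fin N, u.val < n ↔ ∃ s, v s = u)
    {F : OrientedEdges N} {K : Finset ι} (h : IsStage v F K) (l w : Fin N) :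
    ∀ (q : List (Fin N)) (x : ι × Bool), x.1 ∉ K → (v x, v (mate x)) ∈ F →
      (∀ e ∈ pathEdges (v x :: (q ++ [w])), e ∈ F) → (∀ u ∈ q, ¬ IsStop n F l u) →
      Even (q.length + 1) → ∃ D : Finset ι, AltPath v D x q ∧ ∀ k ∈ D, k ∉ K
  | [], _, _, _, _, _, hlen => by simp at hlen
  | [a], x, hx, hxm, hp, _, _ => by
    have ha : a = v (mate x) := h.target_unique _ _ _ (hp _ (by simp [pathEdges])) hxm
    subst ha
    exact ⟨{x.1}, AltPath.last x, by simpa using hx⟩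
  | a :: z :: q, x, hx, hxm, hp, hq, hlen => by
    have hnodup := h.acyclic.nodup hp
    rw [List.cons_append, List.cons_append, pathEdges_cons_cons, pathEdges_cons_cons,
      List.forall_mem_cons, List.forall_mem_cons] at hp
    obtain ⟨hp1, hp2, hp3⟩ := hp
    have ha : a = v (mate x) := h.target_unique _ _ _ hp1 hxm
    subst ha
    have hz := hq z (by simp)
    obtain ⟨s, rfl⟩ := (hroot z).mp (not_le.mp fun hle => hz (Or.inl hle))
    have hs : s.1 ∉ K := h.target _ _ hp2
    have hsm : (v s, v (mate s)) ∈ F := by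
      obtain ⟨y, hy, h1, -⟩ := h.orientation s.1 hs
      rcases eq_or_eq_mate hy with rfl | rfl
      · exact h1
      · rw [mate_mate] at h1
        have hne : v (mate s) ≠ v (mate x) := by
          intro hvv
          have hsx : s = x := by rw [← mate_mate s, hv hvv, mate_mate]
          rw [hsx] at hp2
          exact h.acyclic (v (mate x)) (.head hp2 (.single hxm))
        exact absurd (Or.inr (Or.inl ⟨_, _, hne, h1, hp2⟩)) hz
    obtain ⟨D, hD, hDK⟩ := h.altPath_of_path hv hroot l w q s hs hsm hp3
      (fun u hu => hq u (by simp [hu])) (by simpa [Nat.even_add_one] using hlen)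
    refine ⟨insert x.1 D, AltPath.cons D x s q ?_ hD, fun k hk => ?_⟩
    · intro hxD
      have hmem := hD.mem_iff.mpr (mem_slotVertices.mpr ⟨x, hxD, rfl⟩)
      exact (List.nodup_cons.mp hnodup).1
        (List.mem_cons_of_mem _ (List.mem_append_left [w] hmem))
    · rcases Finset.mem_insert.mp hk with rfl | hk
      · exact hx
      · exact hDK k hk

/-- Removing a trimming path that satisfies the parity condition leads to another stage, and the
path can be grown back. -/
theorem IsStage.trim (hv : Function.Injective v) (hroot : ∀ u : Fin N, u.val < n ↔ ∃ s, v s = u)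
    {F : OrientedEdges N} {K : Finset ι} (h : IsStage v F K) {p : List (Fin N)}
    (hp : IsTrimmingPath n F p) (hgood : IsGoodPath v p) :
    ∃ D : Finset ι, IsStage v (F \ (pathEdges p).toFinset) (D ∪ K) ∧
      ∀ F₂, Grows v K none F₂ → Grows v (D ∪ K) none ((pathEdges p).toFinset ∪ F₂) := by
  obtain ⟨l, q, w, rfl, hl, hpF, hq, hw⟩ := hp
  obtain ⟨⟨x, hx⟩, hlen⟩ := hgood
  rw [length_pathEdges] at hlen
  have hne : (pathEdges (l :: (q ++ [w]))).head? = some (l, (q ++ [w]).head (by simp)) := by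
    cases q <;> rfl
  rw [hne, Option.some_inj, Prod.mk.injEq] at hx
  obtain ⟨rfl, hx⟩ := hx
  have hxm : (v x, v (mate x)) ∈ F := by
    rw [← hx]
    refine hpF _ (List.mem_of_mem_head? ?_)
    rw [hne]; rfl
  have hxK : x.1 ∉ K := by
    obtain ⟨s, hs, hsx⟩ := h.source _ _ hxm
    rwa [← hv hsx]
  obtain ⟨D, hD, hDK⟩ := h.altPath_of_path hv hroot (v x) w q x hxK hxm hpF hq (by simpa using hlen)
  have hnodup := h.acyclic.nodup hpF
  have hout : ∀ s : ι × Bool, s.1 ∈ D → ∀ b, (v s, b) ∈ F →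
      (v s, b) ∈ pathEdges (v x :: (q ++ [w])) := by
    intro s hs b hb
    obtain ⟨b', hb'⟩ := exists_mem_pathEdges_of_mem (w := w)
      (hD.mem_iff.mpr (mem_slotVertices.mpr ⟨s, hs, rfl⟩))
    rwa [h.target_unique _ _ _ hb (hpF _ hb')]
  have hle : ∀ s : ι × Bool, s.1 ∈ D → v x ≤ v s := by
    intro s hs
    rcases List.mem_cons.mp (hD.mem_iff.mpr (mem_slotVertices.mpr ⟨s, hs, rfl⟩)) with h' | h'
    · exact h'.ge
    · exact not_lt.mp fun hlt => hq _ h' (Or.inr (Or.inr hlt))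
  have hwD : ∀ s : ι × Bool, s.1 ∈ D → v s ≠ w := by
    rintro s hs rfl
    have hmem := hD.mem_iff.mpr (mem_slotVertices.mpr ⟨s, hs, rfl⟩)
    rw [← List.cons_append] at hnodup
    exact List.disjoint_of_nodup_append hnodup hmem (by simp)
  refine ⟨D, ⟨?_, ?_, ?_, ?_, ?_, ?_⟩, fun F₂ hF₂ => ?_⟩
  · intro a b hab
    obtain ⟨hab, hab'⟩ := Finset.mem_sdiff.mp hab
    obtain ⟨s, hs, rfl⟩ := h.source _ _ hab
    refine ⟨s, fun hs' => ?_, rfl⟩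
    rcases Finset.mem_union.mp hs' with hs' | hs'
    · exact hab' (List.mem_toFinset.mpr (hout s hs' b hab))
    · exact hs hs'
  · exact fun a b b' hb hb' =>
      h.target_unique a b b' (Finset.mem_sdiff.mp hb).1 (Finset.mem_sdiff.mp hb').1
  · exact h.acyclic.mono Finset.sdiff_subset
  · intro k hk
    rw [Finset.mem_union, not_or] at hk
    obtain ⟨y, hy, h1, z, h2⟩ := h.orientation k hk.2
    have hnot : ∀ t : ι × Bool, t.1 = k → ∀ b, (v t, b) ∉ pathEdges (v x :: (q ++ [w])) := by
      intro t ht b hb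
      have := hD.mem_iff.mp (fst_mem_of_mem_pathEdges hb)
      rw [apply_mem_slotVertices hv, ht] at this
      exact hk.1 this
    refine ⟨y, hy, Finset.mem_sdiff.mpr ⟨h1, ?_⟩, z, Finset.mem_sdiff.mpr ⟨h2, ?_⟩⟩
    · exact fun hmem => hnot y hy _ (List.mem_toFinset.mp hmem)
    · exact fun hmem => hnot (mate y) hy _ (List.mem_toFinset.mp hmem)
  · intro a s has hs
    obtain ⟨has, has'⟩ := Finset.mem_sdiff.mp has
    rcases Finset.mem_union.mp hs with hs | hs
    · -- The start of the path is a leaf, and its interior vertices are not forks.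
      rcases List.mem_cons.mp (hD.mem_iff.mpr (mem_slotVertices.mpr ⟨s, hs, rfl⟩)) with h' | h'
      · rw [h'] at has
        exact hl.1.2 a has
      · obtain ⟨a', ha'⟩ := exists_mem_pathEdges_of_mem_tail (c := v x)
          (List.mem_append_left [w] h')
        have haa : a ≠ a' := fun haa => has' (List.mem_toFinset.mpr (haa ▸ ha'))
        exact hq _ h' (Or.inr (Or.inl ⟨a, a', haa, has, hpF _ ha'⟩))
    · exact h.target a s has hs
  · intro l' hl' s hs
    have hl'F : ∃ z, (l', z) ∈ F := by
      obtain ⟨⟨z, hz⟩, -⟩ := hl'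
      exact ⟨z, (Finset.mem_sdiff.mp hz).1⟩
    have hlt : l' < v x := by
      by_cases hleaf : IsLeaf F l'
      · refine lt_of_le_of_ne (hl.2 l' hleaf) ?_
        rintro rfl
        obtain ⟨⟨z, hz⟩, -⟩ := hl'
        obtain ⟨hz, hz'⟩ := Finset.mem_sdiff.mp hz
        exact hz' (List.mem_toFinset.mpr (hout x hD.start_mem z hz))
      · -- A leaf uncovered by the trimming is the end of the path.
        have hin : ∃ u, (u, l') ∈ F := by
          by_contra hcon
          exact hleaf ⟨hl'F, fun u hu => hcon ⟨u, hu⟩⟩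
        have hpath : ∀ u, (u, l') ∈ F → (u, l') ∈ pathEdges (v x :: (q ++ [w])) := by
          intro u hu
          by_contra hcon
          exact hl'.2 u (Finset.mem_sdiff.mpr ⟨hu, fun hmem => hcon (List.mem_toFinset.mp hmem)⟩)
        obtain ⟨u, hu⟩ := hin
        have hl'w : l' = w := by
          rcases List.mem_append.mp (snd_mem_of_mem_pathEdges (hpath u hu)) with h' | h'
          · exfalso
            obtain ⟨t, ht, rfl⟩ := mem_slotVertices.mp
              (hD.mem_iff.mp (List.mem_cons_of_mem (v x) h'))
            obtain ⟨⟨z, hz⟩, -⟩ := hl'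
            obtain ⟨hz, hz'⟩ := Finset.mem_sdiff.mp hz
            exact hz' (List.mem_toFinset.mpr (hout t ht z hz))
          · simpa using h'
        subst hl'w
        rcases hw with hw | ⟨u₁, u₂, hne', h1, h2⟩ | hw
        · obtain ⟨z, hz⟩ := hl'F
          obtain ⟨t, -, ht⟩ := h.source _ _ hz
          exact absurd ((hroot l').mpr ⟨t, ht⟩) (not_lt.mpr hw)
        · exact absurd (pathEdges_source_unique hnodup (hpath _ h1) (hpath _ h2)) hne'
        · exact hw
    rcases Finset.mem_union.mp hs with hs | hs
    · exact hlt.trans_le (hle s hs)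
    · exact hlt.trans (h.leaf_lt _ hl.1 s hs)
  · refine Grows.start _ x _ (Finset.mem_union_left _ hD.start_mem) (fun s hs => ?_)
      (hD.grows ?_ hDK hF₂)
    · rcases Finset.mem_union.mp hs with hs | hs
      · exact hle s hs
      · exact (h.leaf_lt _ hl.1 s hs).le
    · rw [Finset.mem_compl, mem_slotVertices]
      rintro ⟨s, hs, rfl⟩
      rcases Finset.mem_union.mp hs with hs | hs
      · exact hwD s hs rfl
      · obtain ⟨a, ha⟩ := exists_mem_pathEdges_of_mem_tail (b := v s) (c := v x)
          (l := q ++ [v s]) (by simp)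
        exact h.target a s (hpF _ ha) hs

theorem IsTrimming.grows [Fintype ι] (hv : Function.Injective v)
    (hroot : ∀ u : Fin N, u.val < n ↔ ∃ s, v s = u) {F : OrientedEdges N}
    {ps : List (List (Fin N))} (htrim : IsTrimming n F ps) {K : Finset ι} (h : IsStage v F K)
    (hgood : ∀ p ∈ ps, IsGoodPath v p) {F₂ : OrientedEdges N} (hF₂ : Grows v K none F₂) :
    Grows v Finset.univ none (F ∪ F₂) := by
  induction htrim generalizing K F₂ with
  | done =>
    have hK : K = Finset.univ := Finset.eq_univ_iff_forall.mpr fun k => by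
      by_contra hk
      obtain ⟨_, -, hx, -⟩ := h.orientation k hk
      exact Finset.notMem_empty _ hx
    rwa [Finset.empty_union, ← hK]
  | step F p ps hp htrim ih =>
    rw [List.forall_mem_cons] at hgood
    obtain ⟨D, hD, hgrow⟩ := h.trim hv hroot hp hgood.1
    have := ih hD hgood.2 (hgrow F₂ hF₂)
    obtain ⟨_, _, _, _, _, hpF, _⟩ := hp
    rwa [← Finset.union_assoc, Finset.sdiff_union_of_subset
      fun e he => hpF e (List.mem_toFinset.mp he)] at this

/-- A path grown from the smallest vertex left leads to another stage, and it is the trimming path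
of that stage. -/
theorem IsStage.grow (hv : Function.Injective v) (hroot : ∀ u : Fin N, u.val < n ↔ ∃ s, v s = u)
    {F : OrientedEdges N} {K D : Finset ι} (h : IsStage v F K) (hDK : D ⊆ K) {x : ι × Bool}
    (hmin : ∀ s : ι × Bool, s.1 ∈ K → v x ≤ v s) {q : List (Fin N)} (hq : AltPath v D x q)
    {w : Fin N} (hw : w ∉ slotVertices v K) :
    IsStage v (F ∪ (pathEdges (v x :: (q ++ [w]))).toFinset) (K \ D) ∧
      IsTrimmingPath n (F ∪ (pathEdges (v x :: (q ++ [w]))).toFinset) (v x :: (q ++ [w])) ∧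
      (F ∪ (pathEdges (v x :: (q ++ [w]))).toFinset) \ (pathEdges (v x :: (q ++ [w]))).toFinset
        = F := by
  set E := (pathEdges (v x :: (q ++ [w]))).toFinset with hE
  have memE : ∀ {a b}, (a, b) ∈ E ↔ (a, b) ∈ pathEdges (v x :: (q ++ [w])) :=
    fun {a b} => List.mem_toFinset
  have hxD := hq.start_mem
  have hnodup : (v x :: (q ++ [w])).Nodup := by
    rw [← List.cons_append, List.nodup_append]
    refine ⟨hq.nodup hv, List.nodup_singleton _, fun a ha b hb hab => hw ?_⟩
    obtain rfl := List.mem_singleton.mp hb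
    obtain ⟨s, hs, rfl⟩ := mem_slotVertices.mp (hq.mem_iff.mp ha)
    exact mem_slotVertices.mpr ⟨s, hDK hs, hab⟩
  have hsrc : ∀ {a b}, (a, b) ∈ E → ∃ s : ι × Bool, s.1 ∈ D ∧ v s = a := fun hab =>
    mem_slotVertices.mp (hq.mem_iff.mp (fst_mem_of_mem_pathEdges (memE.mp hab)))
  have hdisj : ∀ {a b b'}, (a, b) ∈ F → (a, b') ∉ E := by
    intro a b b' hab hab'
    obtain ⟨s, hs, rfl⟩ := hsrc hab'
    obtain ⟨t, ht, hts⟩ := h.source _ _ hab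
    rw [hv hts] at ht
    exact ht (hDK hs)
  have hinF : ∀ b ∈ v x :: q, ∀ c, (c, b) ∉ F := by
    intro b hb c hc
    obtain ⟨s, hs, rfl⟩ := mem_slotVertices.mp (hq.mem_iff.mp hb)
    exact h.target _ _ hc (hDK hs)
  have hstart : ∀ c, (c, v x) ∉ F ∪ E := by
    intro c hc
    rcases Finset.mem_union.mp hc with hc | hc
    · exact hinF _ List.mem_cons_self c hc
    · exact (List.nodup_cons.mp hnodup).1 (snd_mem_of_mem_pathEdges (memE.mp hc))
  -- The only new leaf is the start of the path.
  have hleaf : ∀ l, IsLeaf (F ∪ E) l → l = v x ∨ IsLeaf F l := by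
    rintro l ⟨⟨z, hz⟩, hin⟩
    rcases Finset.mem_union.mp hz with hz | hz
    · exact Or.inr ⟨⟨z, hz⟩, fun u hu => hin u (Finset.mem_union_left _ hu)⟩
    · rcases List.mem_cons.mp (fst_mem_of_mem_pathEdges (memE.mp hz)) with h' | h'
      · exact Or.inl h'
      · obtain ⟨a, ha⟩ := exists_mem_pathEdges_of_mem_tail (c := v x)
          (List.mem_append_left [w] h')
        exact absurd (Finset.mem_union_right _ (memE.mpr ha)) (hin a)
  refine ⟨⟨?_, ?_, ?_, ?_, ?_, ?_⟩, ⟨v x, q, w, rfl, ⟨⟨?_, hstart⟩, ?_⟩, ?_, ?_, ?_⟩, ?_⟩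
  · intro a b hab
    rcases Finset.mem_union.mp hab with hab | hab
    · obtain ⟨s, hs, rfl⟩ := h.source _ _ hab
      exact ⟨s, fun hs' => hs (Finset.mem_sdiff.mp hs').1, rfl⟩
    · obtain ⟨s, hs, rfl⟩ := hsrc hab
      exact ⟨s, fun hs' => (Finset.mem_sdiff.mp hs').2 hs, rfl⟩
  · intro a b b' hb hb'
    rcases Finset.mem_union.mp hb with hb | hb <;> rcases Finset.mem_union.mp hb' with hb' | hb'
    · exact h.target_unique _ _ _ hb hb'
    · exact absurd hb' (hdisj hb)
    · exact absurd hb (hdisj hb')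
    · exact pathEdges_target_unique hnodup (memE.mp hb) (memE.mp hb')
  · exact h.acyclic.union_path hnodup hinF
  · intro k hk
    by_cases hkD : k ∈ D
    · obtain ⟨y, hy, h1, z, h2⟩ := hq.exists_orientation w k hkD
      exact ⟨y, hy, Finset.mem_union_right _ (memE.mpr h1), z,
        Finset.mem_union_right _ (memE.mpr h2)⟩
    · obtain ⟨y, hy, h1, z, h2⟩ := h.orientation k fun hkK =>
        hk (Finset.mem_sdiff.mpr ⟨hkK, hkD⟩)
      exact ⟨y, hy, Finset.mem_union_left _ h1, z, Finset.mem_union_left _ h2⟩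
  · intro a s has hs
    obtain ⟨hsK, hsD⟩ := Finset.mem_sdiff.mp hs
    rcases Finset.mem_union.mp has with has | has
    · exact h.target _ _ has hsK
    · rcases List.mem_append.mp (snd_mem_of_mem_pathEdges (memE.mp has)) with h' | h'
      · exact hsD ((apply_mem_slotVertices hv).mp
          (hq.mem_iff.mp (List.mem_cons_of_mem (v x) h')))
      · exact hw (mem_slotVertices.mpr ⟨s, hsK, List.mem_singleton.mp h'⟩)
  · intro l hl s hs
    obtain ⟨hsK, hsD⟩ := Finset.mem_sdiff.mp hs
    rcases hleaf l hl with rfl | hl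
    · refine lt_of_le_of_ne (hmin s hsK) fun hxs => hsD ?_
      rwa [← hv hxs]
    · exact h.leaf_lt l hl s hsK
  · obtain ⟨b, hb⟩ := exists_mem_pathEdges_of_mem (c := v x) (w := w) (q := q) List.mem_cons_self
    exact ⟨b, Finset.mem_union_right _ (memE.mpr hb)⟩
  · intro l hl
    rcases hleaf l hl with rfl | hl
    · exact le_rfl
    · exact (h.leaf_lt l hl x (hDK hxD)).le
  · exact fun e he => Finset.mem_union_right _ (memE.mpr he)
  · intro u hu
    obtain ⟨s, hs, rfl⟩ := mem_slotVertices.mp (hq.mem_iff.mp (List.mem_cons_of_mem (v x) hu))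
    rintro (hge | ⟨a, a', hne, ha, ha'⟩ | hlt)
    · exact absurd ((hroot (v s)).mpr ⟨s, rfl⟩) (not_lt.mpr hge)
    · have hmem : ∀ c, (c, v s) ∈ F ∪ E → (c, v s) ∈ pathEdges (v x :: (q ++ [w])) := by
        intro c hc
        rcases Finset.mem_union.mp hc with hc | hc
        · exact absurd hc (hinF _ (List.mem_cons_of_mem _ hu) c)
        · exact memE.mp hc
      exact hne (pathEdges_source_unique hnodup (hmem a ha) (hmem a' ha'))
    · exact absurd (hmin s (hDK hs)) (not_le.mpr hlt)
  · by_cases hwn : w.val < n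
    · obtain ⟨t, rfl⟩ := (hroot w).mp hwn
      have htK : t.1 ∉ K := fun htK => hw (mem_slotVertices.mpr ⟨t, htK, rfl⟩)
      by_cases hin : ∃ a, (a, v t) ∈ F
      · obtain ⟨a, ha⟩ := hin
        obtain ⟨a', ha'⟩ := exists_mem_pathEdges_of_mem_tail (b := v t) (c := v x)
          (l := q ++ [v t]) (by simp)
        refine Or.inr (Or.inl ⟨a, a', ?_, Finset.mem_union_left _ ha,
          Finset.mem_union_right _ (memE.mpr ha')⟩)
        rintro rfl
        exact hdisj ha (memE.mpr ha')
      · exact Or.inr (Or.inr (h.leaf_lt _ ⟨h.exists_out htK, fun u hu => hin ⟨u, hu⟩⟩ x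
          (hDK hxD)))
    · exact Or.inl (not_lt.mp hwn)
  · rw [Finset.union_sdiff_right]
    exact Finset.sdiff_eq_self_of_disjoint
      (Finset.disjoint_left.mpr fun e he he' => hdisj (a := e.1) (b := e.2) he he')

theorem Grows.exists_trimming (hv : Function.Injective v)
    (hroot : ∀ u : Fin N, u.val < n ↔ ∃ s, v s = u) {K : Finset ι} {F₂ : OrientedEdges N}
    (hF₂ : Grows v K none F₂) {F : OrientedEdges N} (h : IsStage v F K)
    {ps : List (List (Fin N))} (htrim : IsTrimming n F ps) (hgood : ∀ p ∈ ps, IsGoodPath v p) :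
    IsStage v (F ∪ F₂) ∅ ∧ ∃ ps', IsTrimming n (F ∪ F₂) ps' ∧ ∀ p ∈ ps', IsGoodPath v p := by
  induction hcard : K.card using Nat.strong_induction_on generalizing K F F₂ ps with
  | _ m ih =>
    rcases hF₂ with _ | ⟨_, x, _, hx, hmin, hF₂⟩
    · rw [Finset.union_empty]
      exact ⟨h, ps, htrim, hgood⟩
    · obtain ⟨D, q, w, F', hDK, hq, hw, hF', rfl⟩ := hF₂.exists_altPath rfl
      obtain ⟨h1, h2, h3⟩ := h.grow hv hroot hDK hmin hq (Finset.mem_compl.mp hw)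
      have hlt : (K \ D).card < m := by
        rw [← hcard]
        exact Finset.card_lt_card (Finset.sdiff_ssubset hDK ⟨x.1, hq.start_mem⟩)
      rw [← Finset.union_assoc, Finset.union_right_comm]
      refine ih _ hlt hF' h1 (IsTrimming.step _ _ _ h2 (h3.symm ▸ htrim)) ?_ rfl
      refine List.forall_mem_cons.mpr ⟨⟨⟨x, ?_⟩, ?_⟩, hgood⟩
      · obtain ⟨q', rfl⟩ := hq.exists_cons
        rfl
      · rw [length_pathEdges]
        simpa using hq.even_length

end Trimming

/-! ### The pairs of a perfect matching -/

section Matching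

variable {n r : ℕ}

theorem exists_matching_slots {G : SimpleGraph (Fin n)} (M : G.Subgraph)
    (hM : M.IsPerfectMatching) :
    ∃ e : Fin (n / 2) × Bool ≃ Fin n, ∀ s, M.Adj (e s) (e (mate s)) := by
  have hM' := SimpleGraph.Subgraph.isPerfectMatching_iff.mp hM
  choose m hm huniq using hM'
  have hmm : ∀ x, m (m x) = x := fun x => (huniq (m x) x (hm x).symm).symm
  have hne : ∀ x, m x ≠ x := fun x h => M.loopless.irrefl x (by simpa only [h] using hm x)
  -- Each pair is represented by its smaller vertex.
  let f : {x : Fin n // x < m x} × Bool → Fin n := fun s => if s.2 then m s.1 else s.1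
  have hf : Function.Bijective f := by
    constructor
    · rintro ⟨⟨x, hx⟩, b⟩ ⟨⟨y, hy⟩, c⟩ h
      cases b <;> cases c <;>
        simp only [f, Bool.false_eq_true, if_true, if_false] at h
      · subst h; rfl
      · rw [h, hmm] at hx; exact absurd hx (not_lt.mpr hy.le)
      · rw [← h, hmm] at hy; exact absurd hy (not_lt.mpr hx.le)
      · have : x = y := by rw [← hmm x, h, hmm]
        subst this; rfl
    · intro y
      rcases lt_or_gt_of_ne (hne y) with h | h
      · exact ⟨(⟨m y, by rwa [hmm]⟩, true), by simp [f, hmm]⟩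
      · exact ⟨(⟨y, h⟩, false), by simp [f]⟩
  have hcard : Fintype.card {x : Fin n // x < m x} = n / 2 := by
    have := Fintype.card_of_bijective hf
    rw [Fintype.card_prod, Fintype.card_bool, Fintype.card_fin] at this
    omega
  let g : {x : Fin n // x < m x} ≃ Fin (n / 2) := Fintype.equivFinOfCardEq hcard
  refine ⟨(g.symm.prodCongr (Equiv.refl Bool)).trans (Equiv.ofBijective f hf), ?_⟩
  rintro ⟨k, b⟩
  cases b
  · exact hm _
  · exact (hm _).symm

theorem mem_liftedEdges {G : SimpleGraph (Fin n)} {M : G.Subgraph} (hM : M.IsPerfectMatching)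
    {e : Fin (n / 2) × Bool ≃ Fin n} (he : ∀ s, M.Adj (e s) (e (mate s)))
    (a b : Fin (n + r)) : s(a, b) ∈ liftedEdges r M ↔
      ∃ s, (a, b) = (Fin.castAdd r (e s), Fin.castAdd r (e (mate s))) := by
  have hadj : ∀ x y, M.Adj x y → ∃ s, e s = x ∧ e (mate s) = y := by
    intro x y hxy
    obtain ⟨s, rfl⟩ := e.surjective x
    exact ⟨s, rfl, (SimpleGraph.Subgraph.isPerfectMatching_iff.mp hM (e s)).unique (he s) hxy⟩
  constructor
  · rintro ⟨z, hz, hab⟩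
    induction z using Sym2.ind with
    | _ x y =>
      obtain ⟨s, rfl, rfl⟩ := hadj x y hz
      rw [Sym2.map_mk, Sym2.eq_iff] at hab
      rcases hab with ⟨rfl, rfl⟩ | ⟨rfl, rfl⟩
      · exact ⟨s, rfl⟩
      · exact ⟨mate s, by rw [mate_mate]⟩
  · rintro ⟨s, hs⟩
    rw [Prod.mk.injEq] at hs
    obtain ⟨rfl, rfl⟩ := hs
    exact ⟨s(e s, e (mate s)), he s, rfl⟩

/-- The positions of the factors in the product defining the Pfaffian, as slots. -/
def positionSlots (hn : Even n) : Fin (n / 2) × Bool ≃ Fin n where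
  toFun s := ⟨2 * s.1 + (if s.2 then 1 else 0), by
    have := s.1.isLt
    have := Nat.div_mul_cancel hn.two_dvd
    split_ifs <;> omega⟩
  invFun i := (⟨i / 2, by
    have := i.isLt
    have := Nat.div_mul_cancel hn.two_dvd
    omega⟩, decide (i.val % 2 = 1))
  left_inv := by
    rintro ⟨k, b⟩
    cases b
    · simp
    · refine Prod.ext (Fin.ext ?_) ?_
      · simp only [if_true]; omega
      · simp only [if_true, decide_eq_true_eq]; omega
  right_inv := by
    intro i
    refine Fin.ext ?_
    simp only [decide_eq_true_eq]
    split_ifs <;> omega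

theorem pfaffian_eq_pf {𝕜 : Type*} [Field 𝕜] (hn : Even n) (B : Matrix (Fin n) (Fin n) 𝕜) :
    pfaffian B = pf B (positionSlots hn) := by
  unfold pfaffian pf
  rw [if_pos hn, Fintype.card_fin]
  congr 1
  symm
  refine Fintype.sum_equiv (positionSlots hn).permCongr _ _ fun σ => ?_
  unfold pfTerm
  rw [Equiv.Perm.sign_permCongr]
  congr 1
  refine Finset.prod_congr rfl fun k _ => ?_
  have h0 : (positionSlots hn).symm ⟨2 * k.val, by have := k.isLt; omega⟩ = (k, false) := by
    rw [Equiv.symm_apply_eq]; rfl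
  have h1 : (positionSlots hn).symm ⟨2 * k.val + 1, by have := k.isLt; omega⟩ = (k, true) := by
    rw [Equiv.symm_apply_eq]; rfl
  rw [Equiv.permCongr_apply, Equiv.permCongr_apply, h0, h1]

/-- A permutation of the slots that respects the pairs permutes the pairs, which is even, after
having reversed some of them. -/
theorem sign_eq_prod_slotSign {ι : Type*} [Fintype ι] [DecidableEq ι]
    (π : Equiv.Perm (ι × Bool)) (hπ : ∀ k, π (k, true) = mate (π (k, false))) :
    Equiv.Perm.sign π = ∏ k, slotSign (π (k, false)) := by
  have hinj : Function.Injective fun k => (π (k, false)).1 := by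
    intro k l hkl
    rcases eq_or_eq_mate hkl with h | h
    · exact congrArg Prod.fst (π.injective h)
    · rw [← hπ l] at h
      exact absurd (congrArg Prod.snd (π.injective h)) (by simp)
  let ρ : Equiv.Perm ι := Equiv.ofBijective _ (Finite.injective_iff_bijective.mp hinj)
  have hprod : π = Equiv.prodCongrLeft (fun _ : Bool => ρ) * Equiv.prodCongrRight
      (fun k => if (π (k, false)).2 then Equiv.swap false true else 1) := by
    ext1 ⟨k, b⟩
    have h0 : π (k, false) = ((π (k, false)).1, (π (k, false)).2) := rfl
    cases b
    · rw [h0]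
      cases hb : (π (k, false)).2 <;> simp [Equiv.prodCongrLeft, ρ, hb]
    · rw [hπ, h0]
      cases hb : (π (k, false)).2 <;> simp [Equiv.prodCongrLeft, ρ, hb, mate]
  rw [hprod, Equiv.Perm.sign_mul, Equiv.Perm.sign_prodCongrLeft, Equiv.Perm.sign_prodCongrRight,
    ← hprod]
  simp only [Finset.prod_const, Finset.card_univ, Fintype.card_bool, sq, Int.units_mul_self,
    one_mul]
  refine Finset.prod_congr rfl fun k _ => ?_
  unfold slotSign
  split_ifs
  · exact Equiv.Perm.sign_swap (by simp)
  · exact Equiv.Perm.sign_one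

/-! ### Forests as the result of the growth -/

/-- The vertices of the pairs of a matching, among all vertices. -/
def matchingVertex (r : ℕ) (e : Fin (n / 2) × Bool ≃ Fin n) (s : Fin (n / 2) × Bool) :
    Fin (n + r) :=
  Fin.castAdd r (e s)

theorem matchingVertex_injective (e : Fin (n / 2) × Bool ≃ Fin n) :
    Function.Injective (matchingVertex r e) :=
  (Fin.castAdd_injective n r).comp e.injective

theorem lt_iff_exists_matchingVertex (e : Fin (n / 2) × Bool ≃ Fin n) (u : Fin (n + r)) :
    u.val < n ↔ ∃ s, matchingVertex r e s = u := by
  constructor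
  · intro h
    refine ⟨e.symm ⟨u, h⟩, ?_⟩
    rw [matchingVertex, Equiv.apply_symm_apply]
    rfl
  · rintro ⟨s, rfl⟩
    exact (e s).isLt

variable {G : SimpleGraph (Fin n)} {M : G.Subgraph} {GR : SimpleGraph (Fin (n + r))}
  {e : Fin (n / 2) × Bool ≃ Fin n} {F : OrientedEdges (n + r)}

theorem isStage_of_isSpanningForest (hM : M.IsPerfectMatching)
    (he : ∀ s, M.Adj (e s) (e (mate s))) (hF : IsSpanningForest GR F) (hc : IsCompatible M F) :
    IsStage (matchingVertex r e) F ∅ where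
  source a b hab := by
    obtain ⟨s, hs⟩ := (lt_iff_exists_matchingVertex e a).mp (by
      by_contra hlt
      have ha : a = Fin.natAdd n ⟨a - n, by omega⟩ := Fin.ext (by simp; omega)
      rw [ha] at hab
      exact hF.root_out _ _ hab)
    exact ⟨s, Finset.notMem_empty _, hs⟩
  target_unique a b b' hb hb' := by
    by_cases hlt : a.val < n
    · exact (hF.exists_unique_out ⟨a, hlt⟩).unique hb hb'
    · have ha : a = Fin.natAdd n ⟨a - n, by omega⟩ := Fin.ext (by simp; omega)
      rw [ha] at hb
      exact absurd hb (hF.root_out _ _)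
  acyclic := hF.no_cycle
  orientation k _ := by
    obtain ⟨⟨a, b⟩, hab, hs⟩ := hc.1 s(matchingVertex r e (k, false), matchingVertex r e (k, true))
      ((mem_liftedEdges hM he _ _).mpr ⟨(k, false), rfl⟩)
    obtain ⟨y, hy, hyF⟩ : ∃ y : Fin (n / 2) × Bool, y.1 = k ∧
        (matchingVertex r e y, matchingVertex r e (mate y)) ∈ F := by
      rcases Sym2.eq_iff.mp hs with ⟨h1, h2⟩ | ⟨h1, h2⟩
      · exact ⟨(k, false), rfl, by rw [← h1]; exact h2 ▸ hab⟩
      · exact ⟨(k, true), rfl, by rw [← h1]; exact h2 ▸ hab⟩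
    obtain ⟨z, hz, -⟩ := hF.exists_unique_out (e (mate y))
    exact ⟨y, hy, hyF, z, hz⟩
  target _ _ _ := Finset.notMem_empty _
  leaf_lt _ _ s hs := absurd hs (Finset.notMem_empty _)

theorem IsStage.isSpanningForest (hF : IsStage (matchingVertex r e) F ∅)
    (hadj : ∀ a ∈ F, GR.Adj a.1 a.2) : IsSpanningForest GR F where
  adj := hadj
  exists_unique_out u := by
    obtain ⟨z, hz⟩ := hF.exists_out (s := e.symm u) (Finset.notMem_empty _)
    rw [matchingVertex, Equiv.apply_symm_apply] at hz
    exact ⟨z, hz, fun z' hz' => hF.target_unique _ _ _ hz' hz⟩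
  root_out ρ w hw := by
    obtain ⟨s, -, hs⟩ := hF.source _ _ hw
    have := congrArg Fin.val hs
    simp only [matchingVertex, Fin.val_castAdd, Fin.val_natAdd] at this
    have := (e s).isLt
    omega
  no_cycle := hF.acyclic

theorem IsStage.isCompatible (hM : M.IsPerfectMatching) (he : ∀ s, M.Adj (e s) (e (mate s)))
    (hF : IsStage (matchingVertex r e) F ∅) : IsCompatible M F := by
  choose y hy h1 z h2 using fun k => hF.orientation k (Finset.notMem_empty k)
  constructor
  · intro a ha
    induction a using Sym2.ind with
    | _ a b =>
      obtain ⟨s, hs⟩ := (mem_liftedEdges hM he a b).mp ha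
      rw [Prod.mk.injEq] at hs
      obtain ⟨rfl, rfl⟩ := hs
      refine ⟨_, h1 s.1, ?_⟩
      rcases eq_or_eq_mate (hy s.1) with h | h
      · rw [h]; rfl
      · rw [h, mate_mate]; exact Sym2.eq_swap
  · -- The edges outside the matching are those that leave the heads of the matching edges.
    have himage : halfForest M F =
        Finset.univ.image fun k => (matchingVertex r e (mate (y k)), z k) := by
      ext ⟨a, b⟩
      simp only [halfForest, Finset.mem_filter, Finset.mem_image, Finset.mem_univ, true_and,
        mem_liftedEdges hM he]
      constructor
      · rintro ⟨hab, hnot⟩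
        obtain ⟨s, -, rfl⟩ := hF.source _ _ hab
        refine ⟨s.1, ?_⟩
        rcases eq_or_eq_mate (hy s.1).symm with h | h
        · have h1 := h1 s.1
          rw [← h] at h1
          rw [hF.target_unique _ _ _ hab h1] at hnot
          exact absurd ⟨s, rfl⟩ hnot
        · have h2 := h2 s.1
          rw [← h] at h2 ⊢
          rw [hF.target_unique _ _ _ hab h2]
      · rintro ⟨k, hk⟩
        rw [Prod.mk.injEq] at hk
        obtain ⟨rfl, rfl⟩ := hk
        refine ⟨h2 k, ?_⟩
        rintro ⟨s, hs⟩
        rw [Prod.mk.injEq] at hs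
        have hs1 : mate (y k) = s := matchingVertex_injective e hs.1
        have hz : z k = matchingVertex r e (y k) := by
          rw [hs.2, ← hs1, mate_mate]; rfl
        have h2 := h2 k
        rw [hz] at h2
        exact hF.acyclic _ (.head (h1 k) (.single h2))
    rw [himage, Finset.card_image_of_injective, Finset.card_univ, Fintype.card_fin]
    intro k l hkl
    have := matchingVertex_injective e (Prod.mk.inj hkl).1
    have := congrArg Prod.fst this
    simpa [hy] using this

theorem conditionC_iff (hM : M.IsPerfectMatching) (he : ∀ s, M.Adj (e s) (e (mate s))) :
    ConditionC M F ↔ ∃ ps, IsTrimming n F ps ∧ ∀ p ∈ ps, IsGoodPath (matchingVertex r e) p := by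
  refine exists_congr fun ps => and_congr_right fun _ => forall₂_congr fun p _ =>
    and_congr_left fun _ => ?_
  constructor
  · rintro ⟨⟨a, b⟩, hab, hmem⟩
    obtain ⟨s, hs⟩ := (mem_liftedEdges hM he a b).mp hmem
    exact ⟨s, hab.trans (congrArg some hs)⟩
  · rintro ⟨s, hs⟩
    exact ⟨_, hs, (mem_liftedEdges hM he _ _).mpr ⟨s, rfl⟩⟩

theorem Grows.isStage (h : Grows (matchingVertex r e) Finset.univ none F) :
    IsStage (matchingVertex r e) F ∅ ∧
      ∃ ps, IsTrimming n F ps ∧ ∀ p ∈ ps, IsGoodPath (matchingVertex r e) p := by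
  have hempty : IsStage (matchingVertex r e) ∅ Finset.univ :=
    { source := fun _ _ h => absurd h (Finset.notMem_empty _)
      target_unique := fun _ _ _ h => absurd h (Finset.notMem_empty _)
      acyclic := fun a ha => by
        obtain ⟨b, -, hb⟩ := Relation.TransGen.tail'_iff.mp ha
        exact Finset.notMem_empty _ hb
      orientation := fun k hk => absurd (Finset.mem_univ k) hk
      target := fun _ _ h => absurd h (Finset.notMem_empty _)
      leaf_lt := fun _ ⟨⟨_, h⟩, _⟩ => absurd h (Finset.notMem_empty _) }
  have := h.exists_trimming (matchingVertex_injective e) (lt_iff_exists_matchingVertex e) hempty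
    IsTrimming.done (by simp)
  rwa [Finset.empty_union] at this

theorem mem_forests_iff (hM : M.IsPerfectMatching) (he : ∀ s, M.Adj (e s) (e (mate s))) :
    F ∈ forests GR M ↔
      Grows (matchingVertex r e) Finset.univ none F ∧ ∀ a ∈ F, GR.Adj a.1 a.2 := by
  simp only [forests, Finset.mem_filter, Finset.mem_univ, true_and, conditionC_iff hM he]
  constructor
  · rintro ⟨hF, hc, ps, hps, hgood⟩
    refine ⟨?_, hF.adj⟩
    have := hps.grows (matchingVertex_injective e) (lt_iff_exists_matchingVertex e)
      (isStage_of_isSpanningForest hM he hF hc) hgood Grows.nil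
    rwa [Finset.union_empty] at this
  · rintro ⟨hF, hadj⟩
    obtain ⟨h, hps⟩ := hF.isStage
    exact ⟨h.isSpanningForest hadj, h.isCompatible hM he, hps⟩

end Matching

/-! ### Signs -/

section Signs

variable {n r : ℕ} {𝕜 : Type*} [Field 𝕜] {G : SimpleGraph (Fin n)} {M : G.Subgraph}
  {e : Fin (n / 2) × Bool ≃ Fin n} {F : OrientedEdges (n + r)}

theorem exists_isDescription (hn : Even n) (he : ∀ s, M.Adj (e s) (e (mate s)))
    (hF : IsStage (matchingVertex r e) F ∅) : ∃ σ, IsDescription M F σ := by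
  choose y hy h1 _ using fun k => hF.orientation k (Finset.notMem_empty k)
  let f : Fin (n / 2) × Bool → Fin (n / 2) × Bool := fun s => if s.2 then mate (y s.1) else y s.1
  have hf : Function.Bijective f := by
    refine Finite.injective_iff_bijective.mp ?_
    rintro ⟨k, b⟩ ⟨l, c⟩ h
    have hkl : k = l := by
      have := congrArg Prod.fst h
      cases b <;> cases c <;> simpa [f, hy] using this
    subst hkl
    cases b <;> cases c <;> simp [f, mate_ne, (mate_ne _).symm] at h ⊢
  refine ⟨((positionSlots hn).symm.trans (Equiv.ofBijective f hf)).trans e, fun k hk => ?_⟩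
  have h0 : (positionSlots hn).symm ⟨2 * k, by omega⟩ = (⟨k, by omega⟩, false) := by
    rw [Equiv.symm_apply_eq]; rfl
  have h1' : (positionSlots hn).symm ⟨2 * k + 1, hk⟩ = (⟨k, by omega⟩, true) := by
    rw [Equiv.symm_apply_eq]; rfl
  simp only [Equiv.trans_apply, h0, h1', Equiv.ofBijective_apply, f, if_true, Bool.false_eq_true,
    if_false]
  exact ⟨he _, h1 _⟩

/-- The signed product over the edges outside the matching is the weight of the forest, up to the
sign of the reference orientation of the matching. -/
theorem sign_mul_prod_halfForest (hn : Even n) (A : Matrix (Fin (n + r)) (Fin (n + r)) 𝕜)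
    (hM : M.IsPerfectMatching) (he : ∀ s, M.Adj (e s) (e (mate s)))
    (hF : IsStage (matchingVertex r e) F ∅) {σ : Equiv.Perm (Fin n)} (hσ : IsDescription M F σ) :
    ((Equiv.Perm.sign σ : ℤ) : 𝕜) * ∏ a ∈ halfForest M F, A a.1 a.2 =
      ((Equiv.Perm.sign (e.trans (positionSlots hn).symm) : ℤ) : 𝕜) *
        ∏ a ∈ F, edgeWeight A (matchingVertex r e) a := by
  classical
  set b := positionSlots hn with hb
  set v := matchingVertex r e with hv
  have hvinj : Function.Injective v := matchingVertex_injective e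
  let π : Equiv.Perm (Fin (n / 2) × Bool) := (b.trans σ).trans e.symm
  have hπσ : ∀ s, e (π s) = σ (b s) := fun s => e.apply_symm_apply _
  have hdesc : ∀ k, M.Adj (e (π (k, false))) (e (π (k, true))) ∧
      (v (π (k, false)), v (π (k, true))) ∈ F := by
    intro k
    simp only [hv, matchingVertex, hπσ]
    have := k.isLt
    exact hσ k (by omega)
  have hπ : ∀ k, π (k, true) = mate (π (k, false)) := fun k =>
    e.injective ((SimpleGraph.Subgraph.isPerfectMatching_iff.mp hM _).unique (hdesc k).1 (he _))
  have hsign : Equiv.Perm.sign σ =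
      Equiv.Perm.sign (e.trans b.symm) * ∏ k, slotSign (π (k, false)) := by
    rw [← sign_eq_prod_slotSign π hπ, ← Equiv.Perm.sign_mul, ← Equiv.Perm.sign_permCongr b.symm σ]
    congr 1
    ext1 s
    simp [π, Equiv.permCongr_apply]
  have hmatch : ∏ a ∈ F with s(a.1, a.2) ∈ liftedEdges r M, edgeWeight A v a =
      ((∏ k, slotSign (π (k, false)) : ℤˣ) : ℤ) := by
    rw [Units.coe_prod, Int.cast_prod]
    symm
    refine Finset.prod_bij (fun k _ => (v (π (k, false)), v (π (k, true)))) ?_ ?_ ?_ ?_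
    · intro k _
      refine Finset.mem_filter.mpr ⟨(hdesc k).2, (mem_liftedEdges hM he _ _).mpr
        ⟨π (k, false), ?_⟩⟩
      rw [hπ]; rfl
    · intro k _ l _ hkl
      exact congrArg Prod.fst (π.injective (hvinj (Prod.mk.inj hkl).1))
    · rintro ⟨a, c⟩ hac
      obtain ⟨hac, hmem⟩ := Finset.mem_filter.mp hac
      obtain ⟨s, hs⟩ := (mem_liftedEdges hM he _ _).mp hmem
      obtain ⟨⟨k, d⟩, rfl⟩ := π.surjective s
      refine ⟨k, Finset.mem_univ _, ?_⟩
      rw [Prod.mk.injEq] at hs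
      obtain ⟨rfl, rfl⟩ := hs
      cases d
      · rw [hπ]; rfl
      · -- A matching edge is not used in both orientations.
        have hac' : (v (π (k, true)), v (π (k, false))) ∈ F := by
          rw [hπ, mate_mate] at hac
          rw [hπ]; exact hac
        exact absurd (.head (hdesc k).2 (.single hac')) (hF.acyclic _)
    · intro k _
      rw [hπ, edgeWeight_mate A hvinj]
  have hrest : ∏ a ∈ F with s(a.1, a.2) ∉ liftedEdges r M, edgeWeight A v a =
      ∏ a ∈ halfForest M F, A a.1 a.2 := by
    unfold halfForest
    refine Finset.prod_congr (by congr) fun a ha => edgeWeight_of_ne A fun s hs => ?_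
    exact (Finset.mem_filter.mp ha).2 ((mem_liftedEdges hM he _ _).mpr ⟨s, hs⟩)
  rw [← Finset.prod_filter_mul_prod_filter_not F (fun a => s(a.1, a.2) ∈ liftedEdges r M), hmatch,
    hrest, hsign]
  push_cast
  ring

end Signs

end PfaffianHalfTree

open PfaffianHalfTree in
theorem mainTheorem1 {K : Type*} [Field K] [CharZero K] (n r : ℕ) (hn : Even n)
    (AR : Matrix (Fin (n + r)) (Fin (n + r)) K)
    (hskew : AR.transpose = -AR)
    (hsum : ∀ i, ∑ j, AR i j = 0)
    (M₀ : (PfaffianHalfTree.matrixGraph (PfaffianHalfTree.topLeft AR)).Subgraph)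
    (hM₀ : M₀.IsPerfectMatching) :
    (∀ F ∈ PfaffianHalfTree.forests (PfaffianHalfTree.matrixGraph AR) M₀,
      ∃ σ : Equiv.Perm (Fin n), PfaffianHalfTree.IsDescription M₀ F σ) ∧
    ∀ σ : PfaffianHalfTree.OrientedEdges (n + r) → Equiv.Perm (Fin n),
      (∀ F ∈ PfaffianHalfTree.forests (PfaffianHalfTree.matrixGraph AR) M₀,
        PfaffianHalfTree.IsDescription M₀ F (σ F)) →
      PfaffianHalfTree.pfaffian (PfaffianHalfTree.topLeft AR) =
        ∑ F ∈ PfaffianHalfTree.forests (PfaffianHalfTree.matrixGraph AR) M₀,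
          ((Equiv.Perm.sign (σ F) : ℤ) : K) *
            ∏ e ∈ PfaffianHalfTree.halfForest M₀ F, AR e.1 e.2 := by
  classical
  have hskew' : ∀ i j, AR i j = -AR j i := fun i j => congrFun (congrFun hskew j) i
  obtain ⟨e, he⟩ := exists_matching_slots M₀ hM₀
  have hv : Function.Injective (matchingVertex r e) := matchingVertex_injective e
  refine ⟨fun F hF => exists_isDescription hn he ((mem_forests_iff hM₀ he).mp hF).1.isStage.1,
    fun σ hσ => ?_⟩
  rw [Finset.sum_congr rfl fun F hF => sign_mul_prod_halfForest hn AR hM₀ he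
    ((mem_forests_iff hM₀ he).mp hF).1.isStage.1 (hσ F hF), ← Finset.mul_sum]
  -- Grown forests with an edge outside the graph have weight zero.
  have hgrow : ∑ F ∈ forests (matrixGraph AR) M₀,
      ∏ a ∈ F, edgeWeight AR (matchingVertex r e) a =
      ∑ F with Grows (matchingVertex r e) Finset.univ none F,
        ∏ a ∈ F, edgeWeight AR (matchingVertex r e) a := by
    refine Finset.sum_subset (fun F hF => Finset.mem_filter.mpr
      ⟨Finset.mem_univ _, ((mem_forests_iff hM₀ he).mp hF).1⟩) fun F hF hnot => ?_
    have hF := (Finset.mem_filter.mp hF).2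
    obtain ⟨a, ha, hadj⟩ : ∃ a ∈ F, ¬ (matrixGraph AR).Adj a.1 a.2 := by
      by_contra hcon
      push Not at hcon
      exact hnot ((mem_forests_iff hM₀ he).mpr ⟨hF, hcon⟩)
    rw [matrixGraph_adj AR hskew, not_not] at hadj
    refine Finset.prod_eq_zero ha ?_
    rw [edgeWeight_of_ne, hadj]
    rintro s rfl
    have hs := M₀.adj_sub (he s)
    rw [matrixGraph_adj _ (by ext i j; exact hskew' _ _)] at hs
    exact hs hadj
  rw [hgrow, (sum_grows AR hskew' hsum hv Finset.univ).1, subPf_univ, pfaffian_eq_pf hn]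
  set b := positionSlots hn
  have hpf : pf AR (matchingVertex r e) =
      pf (topLeft AR) (b ∘ (e.trans b.symm : Equiv.Perm (Fin (n / 2) × Bool))) := by
    unfold pf pfTerm
    simp [matchingVertex, topLeft]
  rw [hpf, pf_comp_perm, ← mul_assoc, ← Int.cast_mul, ← Units.val_mul, Int.units_mul_self]
  simp
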